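/- For every integer $n\ge 3$ there exists a bounded domain $\Omega\subset\mathbb{C}^n$ with smooth, indeed real-analytic, boundary that is Reinhardt (invariant under $(z_1,\dots,z_n)\mapsto(e^{i\theta_1}z_1,\dots,e^{i\theta_n}z_n)$ for all real $\theta_1,\dots,\theta_n$) and strongly convex (it is convex, and at each boundary point the real Hessian of a local defining function is positive definite on the real tangent space of the boundary), and whose Bergman kernel function has a zero in $\Omega\times\Omega$: there are $z,w\in\Omega$ with $K(z,w)=0$. Here the Bergman kernel function $K$ of $\Omega$ is the reproducing kernel of the space of square-integrable holomorphic functions on $\Omega$: for each $z\in\Omega$ the function $w\mapsto\overline{K(z,w)}$ belongs to this space, and $f(z)=\int_\Omega f(w)K(z,w)\,dV_w$ for every $f$ in the space, where $dV$ is Lebesgue measure. -/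

import Mathlib

open MeasureTheory
open scoped ContDiff ComplexConjugate

/-- A domain in `ℂⁿ`: a nonempty connected open set.  (The topology, boundedness, convexity and
differentiability do not depend on the choice of norm on `ℂⁿ`; the measure `volume` on
`Fin n → ℂ` is Lebesgue measure.) -/
def IsDomainInCn {n : ℕ} (Ω : Set (Fin n → ℂ)) : Prop :=
  IsOpen Ω ∧ IsConnected Ω

/-- A Reinhardt set: invariant under independent rotations of the coordinates. -/
def IsReinhardt {n : ℕ} (Ω : Set (Fin n → ℂ)) : Prop :=
  ∀ c : Fin n → ℂ, (∀ j, ‖c j‖ = 1) → ∀ z ∈ Ω, (fun j => c j * z j) ∈ Ω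

/-- `r` is a (real) defining function of class `C^k` for `Ω` on the open neighbourhood `U` of the
point `p`. -/
structure IsLocalDefiningFunction {n : ℕ} (k : WithTop ℕ∞) (Ω : Set (Fin n → ℂ))
    (p : Fin n → ℂ) (U : Set (Fin n → ℂ)) (r : (Fin n → ℂ) → ℝ) : Prop where
  isOpen : IsOpen U
  mem : p ∈ U
  contDiffOn : ContDiffOn ℝ k r U
  mem_iff : ∀ z ∈ U, z ∈ Ω ↔ r z < 0
  mem_frontier_iff : ∀ z ∈ U, z ∈ frontier Ω ↔ r z = 0
  fderiv_ne_zero : ∀ z ∈ U, fderiv ℝ r z ≠ 0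

/-- `Ω` has boundary of class `C^k`; `k = ∞` means smooth, `k = ω` means real-analytic. -/
def HasBoundaryOfClass {n : ℕ} (k : WithTop ℕ∞) (Ω : Set (Fin n → ℂ)) : Prop :=
  ∀ p ∈ frontier Ω, ∃ U r, IsLocalDefiningFunction k Ω p U r

/-- Strong convexity: `Ω` is convex and has `C²` boundary, and at every boundary point the real
Hessian of a defining function is positive definite on the real tangent space of the boundary. -/
def IsStronglyConvexDomain {n : ℕ} (Ω : Set (Fin n → ℂ)) : Prop :=
  Convex ℝ Ω ∧ ∀ p ∈ frontier Ω, ∃ U r, IsLocalDefiningFunction 2 Ω p U r ∧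
    ∀ v : Fin n → ℂ, v ≠ 0 → fderiv ℝ r p v = 0 → 0 < fderiv ℝ (fderiv ℝ r) p v v

/-- Membership in the Bergman space: holomorphic and square-integrable on `Ω`. -/
def MemBergmanSpace {n : ℕ} (Ω : Set (Fin n → ℂ)) (f : (Fin n → ℂ) → ℂ) : Prop :=
  DifferentiableOn ℂ f Ω ∧ MemLp f 2 (volume.restrict Ω)

/-- `K` is the Bergman kernel function of `Ω`, that is, the reproducing kernel of the Bergman
space: `w ↦ conj K(z,w)` belongs to the space for each `z ∈ Ω`, and
`f(z) = ∫_Ω f(w) K(z,w) dV_w` for every `f` in the space. -/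
structure IsBergmanKernel {n : ℕ} (Ω : Set (Fin n → ℂ))
    (K : (Fin n → ℂ) → (Fin n → ℂ) → ℂ) : Prop where
  mem : ∀ z ∈ Ω, MemBergmanSpace Ω (fun w => conj (K z w))
  reproducing : ∀ f, MemBergmanSpace Ω f → ∀ z ∈ Ω, f z = ∫ w in Ω, f w * K z w

/-- The Bergman kernel of an open set is uniquely determined on the set. -/
theorem IsBergmanKernel.unique {n : ℕ} {Ω : Set (Fin n → ℂ)} (hΩ : IsOpen Ω)
    {K L : (Fin n → ℂ) → (Fin n → ℂ) → ℂ} (hK : IsBergmanKernel Ω K) (hL : IsBergmanKernel Ω L)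
    {z w : Fin n → ℂ} (hz : z ∈ Ω) (hw : w ∈ Ω) : K z w = L z w := by
  set g : (Fin n → ℂ) → ℂ := fun w => conj (K z w) - conj (L z w) with hg
  have hgm : MemBergmanSpace Ω g :=
    ⟨(hK.mem z hz).1.sub (hL.mem z hz).1, (hK.mem z hz).2.sub (hL.mem z hz).2⟩
  have hi : ∀ {M : (Fin n → ℂ) → (Fin n → ℂ) → ℂ}, IsBergmanKernel Ω M →
      Integrable (fun w => g w * M z w) (volume.restrict Ω) := by
    intro M hM
    have h := (hM.mem z hz).2.star
    have h' : MemLp (M z) 2 (volume.restrict Ω) := by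
      convert h using 1
      ext w
      simp
    exact hgm.2.integrable_mul h'
  have h0 : ∫ w in Ω, (g w * K z w - g w * L z w) = 0 := by
    rw [integral_sub (hi hK) (hi hL), ← hK.reproducing g hgm z hz, ← hL.reproducing g hgm z hz,
      sub_self]
  have h1 : ∀ w, g w * K z w - g w * L z w = ((‖g w‖ ^ 2 : ℝ) : ℂ) := by
    intro w
    have : K z w - L z w = conj (g w) := by simp [hg]
    rw [← mul_sub, this, Complex.mul_conj']
    push_cast
    rfl
  simp_rw [h1] at h0
  rw [integral_complex_ofReal, Complex.ofReal_eq_zero,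
    integral_eq_zero_iff_of_nonneg (fun w => by positivity) (hgm.2.integrable_norm_pow (by simp))]
    at h0
  have h2 : g =ᵐ[volume.restrict Ω] fun _ => 0 := by
    filter_upwards [h0] with w hw
    simpa using hw
  have h3 := Measure.eqOn_open_of_ae_eq h2 hΩ hgm.1.continuousOn continuousOn_const hw
  have h4 : conj (K z w) = conj (L z w) := sub_eq_zero.mp h3
  exact (starRingEnd ℂ).injective h4

/-! Write `n = m + 1`. On a bounded complete Reinhardt domain the monomials are orthogonal, and at a
point `(a, 0)` of the first axis only powers of `z₀` survive, so there the kernel is `∑ (a * conj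
w₀)^k / μ_k` with `μ_k = ∫ ‖w₀‖^(2k)`. A single sequence of moments therefore decides whether the
kernel vanishes on this axis.

For the non-smooth domain `‖z₀‖ + ‖z'‖ < 1` the moments are beta integrals, `μ_k = A / choose (2k +
2m + 2) (2m + 1)`. At `z₀ = σ`, `w₀ = -σ` the series is a positive multiple of the odd part of a
binomial series, namely of `Im (1 - iσ)^(-(2m+2)) / σ`. With `σ = tan θ` this has the sign of `sin
((2m+2)θ)`. The condition `σ < 1` means `θ < π/4`, so the angle can pass `π` exactly when `m ≥ 2`,
that is, `n ≥ 3`.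

Replacing both norms by `√(ε² + ‖·‖²)` gives real-analytic strongly convex domains increasing to
this one as `ε` decreases to `0`. Their moments converge, and dominated convergence keeps the kernel
negative for some small `ε` (`exists_smoothedDomain_tsum_neg`). The kernel at `(s, -s)` is real,
continuous in `s` and positive at `s = 0`, hence vanishes for some `s`. The axis formula is
`exists_isBergmanKernel`; off the axis, the Riesz theorem supplies the kernel. -/

open Metric Filter Topology Set
open scoped Pointwise

/-! ### Averaging over rotations of coordinates -/

/-- Multiplication of the coordinates with index in `S` by `c`. -/
def scaleCoords {n : ℕ} (S : Finset (Fin n)) (c : ℂ) (z : Fin n → ℂ) : Fin n → ℂ :=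
  fun j => if j ∈ S then c * z j else z j

theorem continuous_scaleCoords {n : ℕ} (S : Finset (Fin n)) :
    Continuous fun p : ℂ × (Fin n → ℂ) => scaleCoords S p.1 p.2 := by
  refine continuous_pi fun j => ?_
  by_cases hj : j ∈ S <;> simp only [scaleCoords, hj, if_true, if_false] <;> fun_prop

theorem scaleCoords_scaleCoords {n : ℕ} (S : Finset (Fin n)) (c d : ℂ) (z : Fin n → ℂ) :
    scaleCoords S c (scaleCoords S d z) = scaleCoords S (c * d) z := by
  ext j
  by_cases hj : j ∈ S <;> simp [scaleCoords, hj, mul_assoc]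

theorem scaleCoords_one {n : ℕ} (S : Finset (Fin n)) (z : Fin n → ℂ) :
    scaleCoords S 1 z = z := by
  ext j
  simp [scaleCoords]

theorem differentiable_scaleCoords {n : ℕ} (S : Finset (Fin n)) (z : Fin n → ℂ) :
    Differentiable ℂ fun c : ℂ => scaleCoords S c z := by
  refine differentiable_pi.2 fun j => ?_
  by_cases hj : j ∈ S <;> simp only [scaleCoords, hj, if_true, if_false] <;> fun_prop

theorem measurePreserving_scaleCoords {n : ℕ} (S : Finset (Fin n)) {c : ℂ} (hc : ‖c‖ = 1) :
    MeasurePreserving (scaleCoords S c) := by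
  refine volume_preserving_pi (f := fun j (x : ℂ) => if j ∈ S then c * x else x) fun j => ?_
  by_cases hj : j ∈ S
  · simp only [hj, if_true]
    exact (rotation ⟨c, mem_sphere_zero_iff_norm.2 hc⟩).measurePreserving
  · simp only [hj, if_false]
    exact MeasurePreserving.id _

/-- Averaging an integrable function over rotations of some of the coordinates does not change
its integral over a set that is invariant under these rotations. -/
theorem setIntegral_circleAverage_scaleCoords {n : ℕ} (S : Finset (Fin n)) {Ω : Set (Fin n → ℂ)}
    (hΩ : MeasurableSet Ω) (hinv : ∀ c : ℂ, ‖c‖ = 1 → ∀ z ∈ Ω, scaleCoords S c z ∈ Ω)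
    {F : (Fin n → ℂ) → ℂ} (hF : IntegrableOn F Ω) :
    IntegrableOn (fun w => Real.circleAverage (fun c => F (scaleCoords S c w)) 0 1) Ω ∧
      ∫ w in Ω, Real.circleAverage (fun c => F (scaleCoords S c w)) 0 1 = ∫ w in Ω, F w := by
  set μ := volume.restrict Ω
  set ν := (volume : Measure ℝ).restrict (Ioc 0 (2 * Real.pi))
  have hpi : (0 : ℝ) ≤ 2 * Real.pi := by positivity
  have hnorm : ∀ θ, ‖circleMap 0 1 θ‖ = 1 := fun θ => by simp
  have hmp : ∀ c : ℂ, ‖c‖ = 1 → MeasurePreserving (scaleCoords S c) μ μ := by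
    intro c hc
    have h := (measurePreserving_scaleCoords S hc).restrict_preimage hΩ
    have he : scaleCoords S c ⁻¹' Ω = Ω := by
      ext z
      refine ⟨fun hz => ?_, hinv c hc z⟩
      have := hinv c⁻¹ (by simp [hc]) _ hz
      rwa [scaleCoords_scaleCoords, inv_mul_cancel₀ (by rintro rfl; simp at hc),
        scaleCoords_one] at this
    rwa [he] at h
  -- The skew product of all rotations preserves the product measure, which gives the joint
  -- integrability that Fubini requires.
  have hφ : MeasurePreserving
      (fun p : ℝ × (Fin n → ℂ) => (p.1, scaleCoords S (circleMap 0 1 p.1) p.2))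
      (ν.prod μ) (ν.prod μ) := by
    refine (MeasurePreserving.id ν).skew_product (g := fun θ w => scaleCoords S (circleMap 0 1 θ) w)
      ?_ (ae_of_all _ fun θ => (hmp _ (hnorm θ)).map_eq)
    exact ((continuous_scaleCoords S).comp (((continuous_circleMap 0 1).comp continuous_fst).prodMk
      continuous_snd)).measurable
  have hG : Integrable (fun p : ℝ × (Fin n → ℂ) => F (scaleCoords S (circleMap 0 1 p.1) p.2))
      (ν.prod μ) :=
    (hφ.integrable_comp (hF.comp_snd ν).aestronglyMeasurable).2 (hF.comp_snd ν)
  simp only [Real.circleAverage, intervalIntegral.integral_of_le hpi]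
  refine ⟨hG.integral_prod_right.smul _, ?_⟩
  rw [integral_smul, ← integral_integral_swap hG]
  have h1 : ∀ θ : ℝ, ∫ w, F (scaleCoords S (circleMap 0 1 θ) w) ∂μ = ∫ w, F w ∂μ := by
    intro θ
    have h := hmp _ (hnorm θ)
    have h2 := integral_map (μ := μ) (φ := scaleCoords S (circleMap 0 1 θ)) (f := F)
      h.measurable.aemeasurable (by rw [h.map_eq]; exact hF.aestronglyMeasurable)
    rw [← h2, h.map_eq]
  simp only [h1]
  rw [integral_const, measureReal_restrict_apply_univ, Real.volume_real_Ioc_of_le hpi, smul_smul,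
    sub_zero, inv_mul_cancel₀ (by positivity), one_smul]

/-! ### Mean values and bounded point evaluations -/

/-- The ball, a polydisc in the sup norm, is invariant about its centre under simultaneous rotation
of all coordinates. Averaging over these rotations reduces the claim to the mean value property in
one variable. -/
theorem integral_ball_eq_volume_mul {n : ℕ} {f : (Fin n → ℂ) → ℂ} {z : Fin n → ℂ} {r : ℝ}
    (hf : DifferentiableOn ℂ f (ball z r)) (hi : IntegrableOn f (ball z r)) :
    ∫ w in ball z r, f w = volume.real (ball z r) • f z := by
  have hmp := measurePreserving_add_left (volume : Measure (Fin n → ℂ)) z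
  have hpre : (fun w => z + w) ⁻¹' ball z r = ball 0 r := by
    ext w
    simp [dist_eq_norm]
  have hmb : ∀ w ∈ ball (0 : Fin n → ℂ) r, ∀ c : ℂ, ‖c‖ ≤ 1 →
      scaleCoords Finset.univ c w ∈ ball 0 r := by
    intro w hw c hc
    have : scaleCoords Finset.univ c w = c • w := by
      ext j
      simp [scaleCoords]
    rw [mem_ball_zero_iff] at hw ⊢
    rw [this, norm_smul]
    nlinarith [norm_nonneg w]
  have he := (hmp.setIntegral_preimage_emb (measurableEmbedding_addLeft z) f (ball z r))
  rw [hpre] at he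
  have hi' : IntegrableOn (fun w => f (z + w)) (ball 0 r) := by
    rw [← hpre]
    exact (hmp.integrableOn_comp_preimage (measurableEmbedding_addLeft z)).2 hi
  have h := (setIntegral_circleAverage_scaleCoords Finset.univ measurableSet_ball
    (fun c hc w hw => hmb w hw c hc.le) hi').2
  rw [← he, ← h]
  have h2 : EqOn (fun w => Real.circleAverage (fun c => f (z + scaleCoords Finset.univ c w)) 0 1)
      (fun _ => f z) (ball (0 : Fin n → ℂ) r) := by
    intro w hw
    show Real.circleAverage (fun c => f (z + scaleCoords Finset.univ c w)) 0 1 = f z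
    have hd : DifferentiableOn ℂ (fun c => f (z + scaleCoords Finset.univ c w)) (closedBall 0 1) := by
      refine hf.comp ((differentiable_const z).add
        (differentiable_scaleCoords _ w)).differentiableOn fun c hc => ?_
      have := hmb w hw c (by simpa using hc)
      rw [mem_ball_zero_iff] at this
      simpa [mem_ball, dist_eq_norm] using this
    rw [DiffContOnCl.circleAverage]
    · congr 1
      ext j
      simp [scaleCoords]
    · rw [abs_one]
      exact DifferentiableOn.diffContOnCl (by rwa [closure_ball _ one_ne_zero])
  rw [setIntegral_congr_fun measurableSet_ball h2, setIntegral_const]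
  rw [Measure.real, Measure.real, Measure.addHaar_ball_center volume z r]

/-- Point evaluations are bounded on the Bergman space, uniformly at points at distance at least
`r` from the complement. -/
theorem MemBergmanSpace.exists_norm_le (n : ℕ) {r : ℝ} (hr : 0 < r) :
    ∃ C : ℝ, 0 ≤ C ∧ ∀ (Ω : Set (Fin n → ℂ)) (f : (Fin n → ℂ) → ℂ), MemBergmanSpace Ω f →
      ∀ z, ball z r ⊆ Ω → ‖f z‖ ≤ C * (eLpNorm f 2 (volume.restrict Ω)).toReal := by
  set V := (volume : Measure (Fin n → ℂ)) (ball 0 r)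
  have hV : V ≠ ⊤ := measure_ball_lt_top.ne
  have hV0 : 0 < V.toReal := ENNReal.toReal_pos (measure_ball_pos _ _ hr).ne' hV
  -- The constant is the mean value property followed by Hölder's inequality between `L¹` and `L²`
  -- on the ball.
  refine ⟨V.toReal⁻¹ * (V ^ (1 / 2 : ℝ)).toReal, by positivity, fun Ω f hf z hz => ?_⟩
  have hVz : volume (ball z r) = V := Measure.addHaar_ball_center _ _ _
  have hle : volume.restrict (ball z r) ≤ volume.restrict Ω := Measure.restrict_mono hz le_rfl
  have hm2 : MemLp f 2 (volume.restrict (ball z r)) := hf.2.mono_measure hle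
  have : IsFiniteMeasure (volume.restrict (ball z r)) := ⟨by simp [hVz, hV.lt_top]⟩
  have hm1 : MemLp f 1 (volume.restrict (ball z r)) := hm2.mono_exponent (by norm_num)
  have h1 := integral_ball_eq_volume_mul (hf.1.mono hz) (memLp_one_iff_integrable.1 hm1)
  have h2 : V.toReal * ‖f z‖ ≤ (eLpNorm f 1 (volume.restrict (ball z r))).toReal := by
    have h3 := norm_integral_le_integral_norm (μ := volume.restrict (ball z r)) f
    rw [h1, norm_smul, Measure.real, hVz, Real.norm_of_nonneg hV0.le] at h3
    refine h3.trans (le_of_eq ?_)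
    rw [eLpNorm_one_eq_lintegral_enorm, integral_norm_eq_lintegral_enorm hm1.1]
  have h4 : (eLpNorm f 1 (volume.restrict (ball z r))).toReal ≤
      (eLpNorm f 2 (volume.restrict Ω)).toReal * (V ^ (1 / 2 : ℝ)).toReal := by
    rw [← ENNReal.toReal_mul]
    refine ENNReal.toReal_mono (ENNReal.mul_ne_top hf.2.2.ne
      (ENNReal.rpow_ne_top_of_nonneg (by norm_num) hV)) ?_
    refine (eLpNorm_le_eLpNorm_mul_rpow_measure_univ (p := 1) (q := 2) (by norm_num) hm2.1).trans ?_
    rw [Measure.restrict_apply_univ, hVz]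
    have he : 1 / (1 : ENNReal).toReal - 1 / (2 : ENNReal).toReal = (1 / 2 : ℝ) := by norm_num
    rw [he]
    gcongr
  rw [mul_assoc, le_inv_mul_iff₀ hV0, mul_comm (ENNReal.toReal (_ ^ _))]
  exact h2.trans h4

/-! ### Uniform limits of holomorphic functions -/

/-- Cauchy's estimate on the complex line through `x` in direction `v`; a disc of radius `ρ / 2 /
‖v‖` in the parameter stays inside the ball. -/
theorem norm_fderiv_le_of_forall_mem_ball {E : Type*} [NormedAddCommGroup E] [NormedSpace ℂ E]
    {h : E → ℂ} {x : E} {ρ C : ℝ} (hρ : 0 < ρ) (hd : DifferentiableOn ℂ h (ball x ρ))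
    (hC : ∀ y ∈ ball x ρ, ‖h y‖ ≤ C) : ‖fderiv ℂ h x‖ ≤ C / (ρ / 2) := by
  have hC0 : 0 ≤ C := (norm_nonneg _).trans (hC x (mem_ball_self hρ))
  refine ContinuousLinearMap.opNorm_le_bound _ (by positivity) fun v => ?_
  rcases eq_or_ne v 0 with rfl | hv
  · simp
  have hv' : 0 < ‖v‖ := norm_pos_iff.2 hv
  have hmem : ∀ t ∈ closedBall (0 : ℂ) (ρ / 2 / ‖v‖), x + t • v ∈ ball x ρ := by
    intro t ht
    rw [mem_closedBall_zero_iff, le_div_iff₀ hv'] at ht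
    rw [mem_ball, dist_eq_norm, add_sub_cancel_left, norm_smul]
    linarith
  have hdiff : DifferentiableOn ℂ (fun t : ℂ => h (x + t • v)) (closedBall 0 (ρ / 2 / ‖v‖)) :=
    hd.comp (by fun_prop) hmem
  have h1 := Complex.norm_deriv_le_of_forall_mem_sphere_norm_le (f := fun t : ℂ => h (x + t • v))
    (c := 0) (R := ρ / 2 / ‖v‖) (C := C) (by positivity)
    (DifferentiableOn.diffContOnCl (by rwa [closure_ball _ (by positivity)]))
    (fun t ht => hC _ (hmem t (sphere_subset_closedBall ht)))
  have h2 : HasDerivAt (fun t : ℂ => h (x + t • v)) (fderiv ℂ h x v) 0 := by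
    have h3 : HasFDerivAt h (fderiv ℂ h x) (x + (0 : ℂ) • v) := by
      rw [zero_smul, add_zero]
      exact (hd.differentiableAt (ball_mem_nhds x hρ)).hasFDerivAt
    have h4 : HasDerivAt (fun t : ℂ => x + t • v) v 0 := by
      simpa using ((hasDerivAt_id (0 : ℂ)).smul_const v).const_add x
    exact h3.comp_hasDerivAt (0 : ℂ) h4
  rw [h2.deriv] at h1
  calc _ ≤ _ := h1
    _ = _ := by field_simp

/-- A uniform limit of holomorphic functions of several variables is holomorphic. -/
theorem differentiableAt_of_uniformCauchySeqOn {E : Type*} [NormedAddCommGroup E]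
    [NormedSpace ℂ E] {f : ℕ → E → ℂ} {g : E → ℂ} {z : E} {r : ℝ} (hr : 0 < r)
    (hf : ∀ k, DifferentiableOn ℂ (f k) (ball z r))
    (hc : UniformCauchySeqOn f atTop (ball z r))
    (hg : ∀ x ∈ ball z r, Tendsto (fun k => f k x) atTop (𝓝 (g x))) : DifferentiableAt ℂ g z := by
  have hsub : ∀ x ∈ ball z (r / 2), ball x (r / 2) ⊆ ball z r := fun x hx =>
    ball_subset_ball' (by rw [mem_ball] at hx; linarith)
  have hc' : UniformCauchySeqOn (fun k => fderiv ℂ (f k)) atTop (ball z (r / 2)) := by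
    rw [Metric.uniformCauchySeqOn_iff] at hc ⊢
    intro ε hε
    -- Cauchy's estimate on balls of radius `r / 2` costs a factor `4 / r`, leaving `ε / 2`.
    obtain ⟨N, hN⟩ := hc (ε * (r / 8)) (by positivity)
    refine ⟨N, fun k hk l hl x hx => ?_⟩
    have hdk : ∀ k, DifferentiableAt ℂ (f k) x := fun k =>
      (hf k).differentiableAt (isOpen_ball.mem_nhds (ball_subset_ball (by linarith) hx))
    have h := norm_fderiv_le_of_forall_mem_ball (h := fun y => f k y - f l y) (x := x) (ρ := r / 2)
      (C := ε * (r / 8)) (by positivity)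
      (((hf k).sub (hf l)).mono (hsub x hx)) fun y hy => by
        rw [← dist_eq_norm]
        exact (hN k hk l hl y (hsub x hx hy)).le
    rw [fderiv_fun_sub (hdk k) (hdk l)] at h
    rw [dist_eq_norm]
    refine h.trans_lt ?_
    have : ε * (r / 8) / (r / 2 / 2) = ε / 2 := by field_simp; norm_num
    rw [this]
    linarith
  have hlim : ∀ x ∈ ball z (r / 2), ∃ L, Tendsto (fun k => fderiv ℂ (f k) x) atTop (𝓝 L) :=
    fun x hx => cauchySeq_tendsto_of_complete (hc'.cauchySeq hx)
  choose! L hL using hlim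
  exact (hasFDerivAt_of_tendstoUniformlyOn isOpen_ball
    (hc'.tendstoUniformlyOn_of_tendsto hL)
    (fun k x hx => ((hf k).differentiableAt
      (isOpen_ball.mem_nhds (ball_subset_ball (by linarith) hx))).hasFDerivAt)
    (fun x hx => hg x (ball_subset_ball (by linarith) hx))
    (mem_ball_self (half_pos hr))).differentiableAt

/-! ### The Bergman space as a Hilbert space -/

/-- The Bergman space as a subspace of `L²`. -/
def bergmanSubmodule {n : ℕ} (Ω : Set (Fin n → ℂ)) :
    Submodule ℂ (Lp ℂ 2 (volume.restrict Ω)) where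
  carrier := {φ | ∃ f, DifferentiableOn ℂ f Ω ∧ φ =ᵐ[volume.restrict Ω] f}
  add_mem' := by
    rintro φ ψ ⟨f, hf, hφ⟩ ⟨g, hg, hψ⟩
    exact ⟨f + g, hf.add hg, (Lp.coeFn_add φ ψ).trans (hφ.add hψ)⟩
  zero_mem' := ⟨0, differentiableOn_const 0, Lp.coeFn_zero _ _ _⟩
  smul_mem' := by
    rintro c φ ⟨f, hf, hφ⟩
    exact ⟨c • f, hf.const_smul c, (Lp.coeFn_smul c φ).trans (hφ.const_smul c)⟩

theorem memBergmanSpace_of_ae_eq {n : ℕ} {Ω : Set (Fin n → ℂ)} {f : (Fin n → ℂ) → ℂ}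
    {φ : Lp ℂ 2 (volume.restrict Ω)} (hf : DifferentiableOn ℂ f Ω)
    (h : φ =ᵐ[volume.restrict Ω] f) : MemBergmanSpace Ω f :=
  ⟨hf, (memLp_congr_ae h).1 (Lp.memLp φ)⟩

/-- Bounded point evaluations turn `L²` convergence into locally uniform convergence, so the
pointwise limit is holomorphic. It agrees almost everywhere with the `L²` limit along a subsequence.
-/
theorem isClosed_bergmanSubmodule {n : ℕ} {Ω : Set (Fin n → ℂ)} (hΩ : IsOpen Ω) :
    IsClosed (bergmanSubmodule Ω : Set (Lp ℂ 2 (volume.restrict Ω))) := by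
  refine isClosed_of_closure_subset fun φ hφ => ?_
  obtain ⟨u, hu, hlim⟩ := mem_closure_iff_seq_limit.1 hφ
  choose f hf hfu using hu
  have hcau : ∀ z ∈ Ω, ∃ r > 0, ball z r ⊆ Ω ∧ UniformCauchySeqOn f atTop (ball z r) := by
    intro z hz
    obtain ⟨r, hr, hsub⟩ := Metric.isOpen_iff.1 hΩ z hz
    obtain ⟨C, hC0, hC⟩ := MemBergmanSpace.exists_norm_le n (half_pos hr)
    refine ⟨r / 2, half_pos hr, (ball_subset_ball (by linarith)).trans hsub, ?_⟩
    rw [Metric.uniformCauchySeqOn_iff]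
    intro ε hε
    obtain ⟨N, hN⟩ := Metric.cauchySeq_iff.1 hlim.cauchySeq (ε / (C + 1)) (by positivity)
    refine ⟨N, fun k hk l hl x hx => ?_⟩
    have hae : (u k - u l : Lp ℂ 2 (volume.restrict Ω)) =ᵐ[volume.restrict Ω]
        f k - f l := (Lp.coeFn_sub _ _).trans ((hfu k).sub (hfu l))
    have h := hC Ω _ (memBergmanSpace_of_ae_eq ((hf k).sub (hf l)) hae) x
      ((ball_subset_ball' (by rw [mem_ball] at hx; linarith)).trans hsub)
    rw [← eLpNorm_congr_ae hae, ← Lp.norm_def, ← dist_eq_norm] at h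
    rw [dist_eq_norm]
    have hN' := hN k hk l hl
    rw [lt_div_iff₀ (by positivity)] at hN'
    have := dist_nonneg (x := u k) (y := u l)
    exact h.trans_lt (by nlinarith)
  have hpt : ∀ z ∈ Ω, ∃ y, Tendsto (fun k => f k z) atTop (𝓝 y) := by
    intro z hz
    obtain ⟨r, hr, -, hc⟩ := hcau z hz
    exact cauchySeq_tendsto_of_complete (hc.cauchySeq (mem_ball_self hr))
  choose! g hg using hpt
  refine ⟨g, fun z hz => ?_, ?_⟩
  · obtain ⟨r, hr, hsub, hc⟩ := hcau z hz
    exact (differentiableAt_of_uniformCauchySeqOn hr (fun k => (hf k).mono hsub) hc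
      fun x hx => hg x (hsub hx)).differentiableWithinAt
  · obtain ⟨ns, hns, hae⟩ := (tendstoInMeasure_of_tendsto_Lp hlim).exists_seq_tendsto_ae
    filter_upwards [hae, ae_all_iff.2 hfu, ae_restrict_mem hΩ.measurableSet] with w hw hw' hwΩ
    refine tendsto_nhds_unique hw ?_
    simp only [hw']
    exact (hg w hwΩ).comp hns.tendsto_atTop

/-- Every point evaluation on the Bergman space of an open set is represented by an element of
the space. -/
theorem exists_bergman_representer {n : ℕ} {Ω : Set (Fin n → ℂ)} (hΩ : IsOpen Ω)
    {z : Fin n → ℂ} (hz : z ∈ Ω) :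
    ∃ g, MemBergmanSpace Ω g ∧
      ∀ f, MemBergmanSpace Ω f → f z = ∫ w in Ω, f w * conj (g w) := by
  have hcomp : CompleteSpace (bergmanSubmodule Ω) :=
    (isClosed_bergmanSubmodule hΩ).completeSpace_coe
  choose rep hrep hae using fun φ : bergmanSubmodule Ω => φ.2
  -- Holomorphic representatives that agree almost everywhere agree at `z`; hence evaluation through
  -- chosen representatives is linear.
  have huniq : ∀ {f h : (Fin n → ℂ) → ℂ}, DifferentiableOn ℂ f Ω → DifferentiableOn ℂ h Ω →
      f =ᵐ[volume.restrict Ω] h → f z = h z := fun hf hh h =>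
    Measure.eqOn_open_of_ae_eq h hΩ hf.continuousOn hh.continuousOn hz
  obtain ⟨r, hr, hsub⟩ := Metric.isOpen_iff.1 hΩ z hz
  obtain ⟨C, hC0, hC⟩ := MemBergmanSpace.exists_norm_le n hr
  let ev : bergmanSubmodule Ω →ₗ[ℂ] ℂ :=
    { toFun := fun φ => rep φ z
      map_add' := fun φ ψ => huniq (hrep _) ((hrep φ).add (hrep ψ))
        ((hae _).symm.trans ((Lp.coeFn_add _ _).trans ((hae φ).add (hae ψ))))
      map_smul' := fun c φ => huniq (hrep _) ((hrep φ).const_smul c)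
        ((hae _).symm.trans ((Lp.coeFn_smul c _).trans ((hae φ).const_smul c))) }
  let evL : StrongDual ℂ (bergmanSubmodule Ω) := ev.mkContinuous C fun φ => by
    have h := hC Ω _ (memBergmanSpace_of_ae_eq (hrep φ) (hae φ)) z hsub
    rwa [← eLpNorm_congr_ae (hae φ), ← Lp.norm_def] at h
  set γ := (InnerProductSpace.toDual ℂ (bergmanSubmodule Ω)).symm evL
  refine ⟨rep γ, memBergmanSpace_of_ae_eq (hrep γ) (hae γ), fun f hf => ?_⟩
  let φ : bergmanSubmodule Ω := ⟨hf.2.toLp f, f, hf.1, hf.2.coeFn_toLp⟩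
  have h1 : inner ℂ γ φ = rep φ z := InnerProductSpace.toDual_symm_apply
  have h2 : rep φ z = f z := huniq (hrep φ) hf.1 ((hae φ).symm.trans hf.2.coeFn_toLp)
  rw [← h2, ← h1, Submodule.coe_inner, L2.inner_def]
  refine integral_congr_ae ?_
  filter_upwards [hae γ, hf.2.coeFn_toLp] with w hw hw'
  rw [RCLike.inner_apply, hw]
  change hf.2.toLp f w * _ = _
  rw [hw']

/-! ### The kernel on the first axis of a complete Reinhardt domain -/

/-- On the unit circle `conj c = c⁻¹`, so this is Cauchy's formula for the `k`-th derivative. -/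
theorem circleAverage_mul_conj_pow {h : ℂ → ℂ} (hh : DifferentiableOn ℂ h (closedBall 0 1))
    (k : ℕ) : Real.circleAverage (fun c => h c * conj c ^ k) 0 1 =
      (k.factorial : ℂ)⁻¹ * iteratedDeriv k h 0 := by
  have h1 := hh.circleIntegral_one_div_sub_center_pow_smul one_pos k
  have h2 : Real.circleAverage (fun c => h c * conj c ^ k) 0 1 =
      Real.circleAverage (fun c => (1 / (c - 0) ^ k) • h c) 0 1 := by
    refine Real.circleAverage_congr_sphere fun c hc => ?_
    have hc1 : ‖c‖ = 1 := by simpa using hc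
    rw [← Complex.inv_eq_conj hc1]
    simp [mul_comm]
  rw [h2, Real.circleAverage_eq_circleIntegral one_ne_zero]
  have h3 : ∀ z : ℂ, (z - 0)⁻¹ • (1 / (z - 0) ^ k) • h z = (1 / (z - 0) ^ (k + 1)) • h z := by
    intro z
    rw [smul_smul, pow_succ, one_div, one_div, mul_inv_rev]
  simp only [h3]
  rw [h1, smul_smul, smul_eq_mul]
  congr 1
  have := Complex.two_pi_I_ne_zero
  field_simp

/-- A bounded open set containing with each point the polydisc spanned by it, and contained in the
cylinder over the unit disc of the first coordinate. -/
structure IsCompleteReinhardtInCylinder {m : ℕ} (Ω : Set (Fin (m + 1) → ℂ)) : Prop where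
  isOpen : IsOpen Ω
  isBounded : Bornology.IsBounded Ω
  mul_mem : ∀ c : Fin (m + 1) → ℂ, (∀ j, ‖c j‖ ≤ 1) → ∀ z ∈ Ω, (fun j => c j * z j) ∈ Ω
  norm_le : ∀ z ∈ Ω, ‖z 0‖ ≤ 1

/-- The squared norm of the `k`-th power of the first coordinate. -/
noncomputable def firstMoment {m : ℕ} (Ω : Set (Fin (m + 1) → ℂ)) (k : ℕ) : ℝ :=
  ∫ w in Ω, ‖w 0‖ ^ (2 * k)

/-- The part of a set on the first coordinate axis. -/
def firstAxisSlice {m : ℕ} (Ω : Set (Fin (m + 1) → ℂ)) : Set ℂ :=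
  {ζ | (Pi.single 0 ζ : Fin (m + 1) → ℂ) ∈ Ω}

theorem differentiable_single_zero {m : ℕ} :
    Differentiable ℂ fun ζ : ℂ => (Pi.single 0 ζ : Fin (m + 1) → ℂ) :=
  (ContinuousLinearMap.single ℂ (fun _ : Fin (m + 1) => ℂ) 0).differentiable

namespace IsCompleteReinhardtInCylinder

variable {m : ℕ} {Ω : Set (Fin (m + 1) → ℂ)}

theorem scaleCoords_mem (h : IsCompleteReinhardtInCylinder Ω) (S : Finset (Fin (m + 1))) {c : ℂ}
    (hc : ‖c‖ ≤ 1) {z : Fin (m + 1) → ℂ} (hz : z ∈ Ω) : scaleCoords S c z ∈ Ω := by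
  have h1 := h.mul_mem (fun j => if j ∈ S then c else 1) (fun j => by split_ifs <;> simp [hc]) z hz
  convert h1 using 2 with j
  by_cases hj : j ∈ S <;> simp [scaleCoords, hj]

theorem isOpen_slice (h : IsCompleteReinhardtInCylinder Ω) : IsOpen (firstAxisSlice Ω) :=
  h.isOpen.preimage differentiable_single_zero.continuous

theorem apply_zero_mem_slice (h : IsCompleteReinhardtInCylinder Ω) {z : Fin (m + 1) → ℂ}
    (hz : z ∈ Ω) : z 0 ∈ firstAxisSlice Ω := by
  have h1 := h.scaleCoords_mem (Finset.univ.erase 0) (c := 0) (by simp) hz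
  change (Pi.single 0 (z 0) : Fin (m + 1) → ℂ) ∈ Ω
  convert h1 using 1
  ext j
  by_cases hj : j = 0
  · subst hj; simp [scaleCoords]
  · simp [scaleCoords, hj]

theorem mul_mem_slice (h : IsCompleteReinhardtInCylinder Ω) {c ζ : ℂ} (hc : ‖c‖ ≤ 1)
    (hζ : ζ ∈ firstAxisSlice Ω) : c * ζ ∈ firstAxisSlice Ω := by
  have h1 := h.mul_mem (fun _ => c) (fun _ => hc) _ hζ
  change (Pi.single 0 (c * ζ) : Fin (m + 1) → ℂ) ∈ Ω
  convert h1 using 1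
  ext j
  by_cases hj : j = 0
  · subst hj; simp
  · simp [hj]

theorem mem_slice_of_norm_le (h : IsCompleteReinhardtInCylinder Ω) {ζ ξ : ℂ} (hle : ‖ζ‖ ≤ ‖ξ‖)
    (hξ : ξ ∈ firstAxisSlice Ω) : ζ ∈ firstAxisSlice Ω := by
  rcases eq_or_ne ξ 0 with rfl | h0
  · rw [norm_zero, norm_le_zero_iff] at hle
    rwa [hle]
  · have := h.mul_mem_slice (c := ζ / ξ) (by
      rw [norm_div]; exact div_le_one_of_le₀ hle (norm_nonneg _)) hξ
    rwa [div_mul_cancel₀ _ h0] at this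

/-- Openness allows a small step outward along the ray through `a`. The gap between `‖a‖` and `‖b‖`
is what makes the kernel series and Taylor series at `a` converge. -/
theorem exists_norm_lt_mem_slice (h : IsCompleteReinhardtInCylinder Ω) {a : ℂ}
    (ha : a ∈ firstAxisSlice Ω) : ∃ b ∈ firstAxisSlice Ω, ‖a‖ < ‖b‖ := by
  obtain ⟨δ, hδ, hsub⟩ := Metric.isOpen_iff.1 h.isOpen_slice a ha
  obtain ⟨u, hu1, hu⟩ : ∃ u : ℂ, ‖u‖ = 1 ∧ a = ‖a‖ * u :=
    ⟨Complex.exp (a.arg * Complex.I), Complex.norm_exp_ofReal_mul_I _,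
      (Complex.norm_mul_exp_arg_mul_I a).symm⟩
  refine ⟨((‖a‖ + δ / 2 : ℝ) : ℂ) * u, hsub ?_, ?_⟩
  · rw [mem_ball, dist_eq_norm]
    have : ((‖a‖ + δ / 2 : ℝ) : ℂ) * u - a = ((δ / 2 : ℝ) : ℂ) * u := by
      nth_rw 2 [hu]; push_cast; ring
    rw [this, norm_mul, hu1, Complex.norm_real, Real.norm_of_nonneg (by positivity)]
    linarith
  · rw [norm_mul, hu1, Complex.norm_real, Real.norm_of_nonneg (by positivity)]
    linarith

theorem isFiniteMeasure (h : IsCompleteReinhardtInCylinder Ω) :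
    IsFiniteMeasure (volume.restrict Ω) :=
  ⟨by rw [Measure.restrict_apply_univ]; exact h.isBounded.measure_lt_top⟩

theorem integrableOn_norm_pow (h : IsCompleteReinhardtInCylinder Ω) (k : ℕ) :
    IntegrableOn (fun w : Fin (m + 1) → ℂ => ‖w 0‖ ^ k) Ω := by
  have := h.isFiniteMeasure
  refine Integrable.of_bound (Continuous.aestronglyMeasurable (by fun_prop)) 1 ?_
  filter_upwards [ae_restrict_mem h.isOpen.measurableSet] with w hw
  rw [norm_pow, norm_norm]
  exact pow_le_one₀ (norm_nonneg _) (h.norm_le w hw)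

theorem pow_mul_volume_le_firstMoment (h : IsCompleteReinhardtInCylinder Ω) {p : ℝ} (hp : 0 ≤ p)
    {U : Set (Fin (m + 1) → ℂ)} (hU : MeasurableSet U) (hsub : U ⊆ Ω) (hpU : ∀ z ∈ U, p ≤ ‖z 0‖)
    (k : ℕ) : (p ^ 2) ^ k * volume.real U ≤ firstMoment Ω k := by
  have hi := h.integrableOn_norm_pow (2 * k)
  calc (p ^ 2) ^ k * volume.real U = ∫ _ in U, (p ^ 2) ^ k := by
        rw [setIntegral_const, smul_eq_mul, mul_comm]
    _ ≤ ∫ w in U, ‖w 0‖ ^ (2 * k) := by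
        refine setIntegral_mono_on
          (integrableOn_const ((measure_mono hsub).trans_lt h.isBounded.measure_lt_top).ne)
          (hi.mono_set hsub) hU fun z hz => ?_
        rw [← pow_mul]
        exact pow_le_pow_left₀ hp (hpU z hz) _
    _ ≤ _ := setIntegral_mono_set hi (ae_of_all _ fun w => by positivity) hsub.eventuallyLE

theorem volume_real_pos (h : IsCompleteReinhardtInCylinder Ω) {U : Set (Fin (m + 1) → ℂ)}
    (hU : IsOpen U) (hsub : U ⊆ Ω) (hne : U.Nonempty) : 0 < volume.real U :=
  ENNReal.toReal_pos (hU.measure_pos volume hne).ne'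
    ((measure_mono hsub).trans_lt h.isBounded.measure_lt_top).ne

theorem firstMoment_pos (h : IsCompleteReinhardtInCylinder Ω) (h0 : 0 ∈ firstAxisSlice Ω) (k : ℕ) :
    0 < firstMoment Ω k := by
  obtain ⟨b, hb, hb0⟩ := h.exists_norm_lt_mem_slice h0
  rw [norm_zero] at hb0
  set U := Ω ∩ {z : Fin (m + 1) → ℂ | ‖b‖ / 2 < ‖z 0‖}
  have hU : IsOpen U := h.isOpen.inter (isOpen_lt (by fun_prop) (by fun_prop))
  have hne : U.Nonempty := ⟨Pi.single 0 b, hb, by simpa using hb0⟩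
  have hv := h.volume_real_pos hU inter_subset_left hne
  exact lt_of_lt_of_le (by positivity) (h.pow_mul_volume_le_firstMoment
    (p := ‖b‖ / 2) (by positivity) hU.measurableSet inter_subset_left (fun z hz => hz.2.le) k)

/-- With `R` the supremum of `‖w 0‖`, take `B = ‖a‖ * R`. Since `‖a‖ < R`, some `p < R` has `B < p ^
2`, while the part of `Ω` where `‖w 0‖ > p` forces the moments to be at least a multiple of `p ^ (2
* k)`. The one majorant serves holomorphy, termwise integration, the limit in `ε` and continuity. -/
theorem exists_summable_pow_div_firstMoment (h : IsCompleteReinhardtInCylinder Ω) {a : ℂ}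
    (ha : a ∈ firstAxisSlice Ω) :
    ∃ B : ℝ, 0 ≤ B ∧ (∀ w ∈ Ω, ‖a‖ * ‖w 0‖ ≤ B) ∧ Summable fun k => B ^ k / firstMoment Ω k := by
  set s := (fun w : Fin (m + 1) → ℂ => ‖w 0‖) '' Ω
  have hs : BddAbove s := ⟨1, by rintro _ ⟨w, hw, rfl⟩; exact h.norm_le w hw⟩
  set R := sSup s
  have hR : ∀ w ∈ Ω, ‖w 0‖ ≤ R := fun w hw => le_csSup hs ⟨w, hw, rfl⟩
  obtain ⟨b, hb, hab⟩ := h.exists_norm_lt_mem_slice ha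
  have haR : ‖a‖ < R := hab.trans_le (by simpa using hR _ hb)
  have hR0 : 0 < R := (norm_nonneg a).trans_lt haR
  have hlt : √(‖a‖ * R) < R := by
    rw [Real.sqrt_lt' hR0, sq]
    exact mul_lt_mul_of_pos_right haR hR0
  obtain ⟨p, hp, hpR⟩ := exists_between hlt
  obtain ⟨_, ⟨w, hw, rfl⟩, hpw⟩ := exists_lt_of_lt_csSup (⟨_, _, ha, rfl⟩ : s.Nonempty) hpR
  have hp0 : 0 < p := (Real.sqrt_nonneg _).trans_lt hp
  have hBp : ‖a‖ * R < p ^ 2 := by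
    rwa [Real.sqrt_lt' hp0] at hp
  set U := Ω ∩ {z : Fin (m + 1) → ℂ | p < ‖z 0‖}
  have hU : IsOpen U := h.isOpen.inter (isOpen_lt (by fun_prop) (by fun_prop))
  have hv := h.volume_real_pos hU inter_subset_left ⟨w, hw, hpw⟩
  have hB0 : 0 ≤ ‖a‖ * R := by positivity
  refine ⟨‖a‖ * R, hB0, fun w hw => by gcongr; exact hR w hw, ?_⟩
  have hle := h.pow_mul_volume_le_firstMoment hp0.le hU.measurableSet inter_subset_left
    (fun z hz => hz.2.le)
  refine Summable.of_nonneg_of_le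
    (fun k => div_nonneg (by positivity) ((by positivity : (0 : ℝ) ≤ _).trans (hle k)))
    (fun k => ?_)
    ((summable_geometric_of_lt_one (r := ‖a‖ * R / p ^ 2) (by positivity)
      ((div_lt_one (by positivity)).2 hBp)).mul_right (volume.real U)⁻¹)
  calc (‖a‖ * R) ^ k / firstMoment Ω k ≤ (‖a‖ * R) ^ k / ((p ^ 2) ^ k * volume.real U) :=
        div_le_div_of_nonneg_left (by positivity) (by positivity) (hle k)
    _ = _ := by rw [div_pow, div_mul_eq_div_div, div_eq_mul_inv _ (volume.real U)]

/-- Integration against a power of the conjugate of the first coordinate extracts a Taylor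
coefficient along the first axis. -/
theorem integral_mul_conj_pow (h : IsCompleteReinhardtInCylinder Ω) {f : (Fin (m + 1) → ℂ) → ℂ}
    (hf : DifferentiableOn ℂ f Ω) (hi : IntegrableOn f Ω) (k : ℕ) :
    ∫ w in Ω, f w * conj (w 0) ^ k =
      (k.factorial : ℂ)⁻¹ * iteratedDeriv k (fun ζ => f (Pi.single 0 ζ)) 0 * firstMoment Ω k := by
  set g : ℂ → ℂ := fun ζ => f (Pi.single 0 ζ)
  have hg : DifferentiableOn ℂ g (firstAxisSlice Ω) :=
    hf.comp differentiable_single_zero.differentiableOn fun ζ hζ => hζ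
  have hF : IntegrableOn (fun w => f w * conj (w 0) ^ k) Ω := by
    refine Integrable.mul_bdd (c := 1) hi (Continuous.aestronglyMeasurable (by fun_prop)) ?_
    filter_upwards [ae_restrict_mem h.isOpen.measurableSet] with w hw
    rw [norm_pow, RCLike.norm_conj]
    exact pow_le_one₀ (norm_nonneg _) (h.norm_le w hw)
  -- Rotating all coordinates but the first replaces `f w` by its value at `(w 0, 0)`, by the mean
  -- value property.
  have h1 := setIntegral_circleAverage_scaleCoords (Finset.univ.erase 0) h.isOpen.measurableSet
    (fun c hc z hz => h.scaleCoords_mem _ hc.le hz) hF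
  have e1 : EqOn (fun w => Real.circleAverage (fun c => f (scaleCoords (Finset.univ.erase 0) c w) *
      conj (scaleCoords (Finset.univ.erase 0) c w 0) ^ k) 0 1)
      (fun w => g (w 0) * conj (w 0) ^ k) Ω := by
    intro w hw
    have hd : DifferentiableOn ℂ (fun c => f (scaleCoords (Finset.univ.erase 0) c w) *
        conj (w 0) ^ k) (closedBall 0 1) :=
      (hf.comp (differentiable_scaleCoords _ w).differentiableOn fun c hc =>
        h.scaleCoords_mem _ (by simpa using hc) hw).mul_const _
    have e : ∀ c, scaleCoords (Finset.univ.erase 0) c w 0 = w 0 := fun c => by simp [scaleCoords]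
    simp only [e]
    rw [DiffContOnCl.circleAverage]
    · congr 2
      ext j
      by_cases hj : j = 0
      · subst hj; simp [scaleCoords]
      · simp [scaleCoords, hj]
    · rw [abs_one]
      exact DifferentiableOn.diffContOnCl (by rwa [closure_ball _ one_ne_zero])
  have hF2 : IntegrableOn (fun w : Fin (m + 1) → ℂ => g (w 0) * conj (w 0) ^ k) Ω :=
    h1.1.congr_fun e1 h.isOpen.measurableSet
  -- Rotating the first coordinate then isolates the `k`-th Taylor coefficient of `g`.
  have h2 := (setIntegral_circleAverage_scaleCoords {0} h.isOpen.measurableSet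
    (fun c hc z hz => h.scaleCoords_mem _ hc.le hz) hF2).2
  rw [← h1.2, setIntegral_congr_fun h.isOpen.measurableSet e1, ← h2, firstMoment,
    ← integral_complex_ofReal, ← integral_const_mul]
  refine setIntegral_congr_fun h.isOpen.measurableSet fun w hw => ?_
  have hw0 := h.apply_zero_mem_slice hw
  have hd : DifferentiableOn ℂ (fun c => g (w 0 * c) * conj (w 0) ^ k) (closedBall 0 1) := by
    refine (hg.comp (by fun_prop) fun c hc => ?_).mul_const _
    rw [mul_comm]
    exact h.mul_mem_slice (by simpa using hc) hw0
  have e : ∀ c, g (scaleCoords {0} c w 0) * conj (scaleCoords {0} c w 0) ^ k =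
      (g (w 0 * c) * conj (w 0) ^ k) * conj c ^ k := fun c => by
    simp [scaleCoords, mul_pow, mul_comm]
    ring
  have hz : (0 : ℂ) ∈ firstAxisSlice Ω := by simpa using h.mul_mem_slice (c := 0) (by simp) hw0
  -- Derivatives within the slice are used because `g` is holomorphic only there. The bound `‖w 0‖ ≤
  -- 1` ensures that multiplication by `w 0` maps the slice into itself.
  have h3 := iteratedDerivWithin_comp_const_smul (n := k) (x := 0) (f := g) hz
    h.isOpen_slice.uniqueDiffOn (hg.contDiffOn h.isOpen_slice) (w 0)
    (fun ζ hζ => h.mul_mem_slice (h.norm_le w hw) hζ)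
  rw [iteratedDerivWithin_of_isOpen h.isOpen_slice hz,
    iteratedDerivWithin_of_isOpen h.isOpen_slice (by rwa [mul_zero]), mul_zero] at h3
  simp only [e]
  rw [circleAverage_mul_conj_pow hd]
  have h4 : iteratedDeriv k (fun c => g (w 0 * c) * conj (w 0) ^ k) 0 =
      w 0 ^ k * iteratedDeriv k g 0 * conj (w 0) ^ k := by
    rw [show (fun c => g (w 0 * c) * conj (w 0) ^ k) = fun c => conj (w 0) ^ k * g (w 0 * c) from
      funext fun c => mul_comm _ _, iteratedDeriv_const_mul_field, h3, smul_eq_mul, mul_comm]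
  have h5 : ((‖w 0‖ ^ (2 * k) : ℝ) : ℂ) = w 0 ^ k * conj (w 0) ^ k := by
    rw [← mul_pow, Complex.mul_conj', pow_mul]
    push_cast
    rfl
  rw [h4, h5]
  ring

/-- The values at points of the first axis of the kernel function. -/
theorem exists_isBergmanKernel (h : IsCompleteReinhardtInCylinder Ω) :
    ∃ K, IsBergmanKernel Ω K ∧ ∀ (a : ℂ) (w : Fin (m + 1) → ℂ),
      K (Pi.single 0 a) w = ∑' k, (a * conj (w 0)) ^ k / firstMoment Ω k := by
  classical
  have := h.isFiniteMeasure
  choose! G hG hGr using fun z (hz : z ∈ Ω) => exists_bergman_representer h.isOpen hz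
  -- The defining conditions concern each `z` separately, so the explicit series on the axis can be
  -- combined with Riesz representers elsewhere.
  let K : (Fin (m + 1) → ℂ) → (Fin (m + 1) → ℂ) → ℂ := fun z w =>
    if z = Pi.single 0 (z 0) then ∑' k, (z 0 * conj (w 0)) ^ k / (firstMoment Ω k : ℂ)
    else conj (G z w)
  have hK1 : ∀ a w, K (Pi.single 0 a) w = ∑' k, (a * conj (w 0)) ^ k / (firstMoment Ω k : ℂ) := by
    intro a w
    simp [K]
  have hK2 : ∀ z, (¬ z = Pi.single 0 (z 0)) → ∀ w, K z w = conj (G z w) := by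
    intro z hz w
    simp only [K, if_neg hz]
  refine ⟨K, ⟨fun z hz => ?_, fun f hf z hz => ?_⟩, hK1⟩
  · by_cases hza : z = Pi.single 0 (z 0)
    · set a := z 0
      rw [hza] at hz ⊢
      obtain ⟨B, hB0, hB, hsum⟩ := h.exists_summable_pow_div_firstMoment hz
      have h0 := h.mem_slice_of_norm_le (ζ := 0) (by simp) hz
      have hterm : ∀ k (ζ : ℂ), ζ ∈ firstAxisSlice Ω →
          ‖(conj a * ζ) ^ k / (firstMoment Ω k : ℂ)‖ ≤ B ^ k / firstMoment Ω k := by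
        intro k ζ hζ
        have hpos := h.firstMoment_pos h0 k
        rw [norm_div, norm_pow, norm_mul, RCLike.norm_conj, Complex.norm_real,
          Real.norm_of_nonneg hpos.le]
        have := hB _ hζ
        rw [Pi.single_eq_same] at this
        gcongr
      have hd : DifferentiableOn ℂ (fun ζ => ∑' k, (conj a * ζ) ^ k / (firstMoment Ω k : ℂ))
          (firstAxisSlice Ω) :=
        Complex.differentiableOn_tsum_of_summable_norm hsum (fun k => by fun_prop) h.isOpen_slice
          hterm
      have he : (fun w => conj (K (Pi.single 0 a) w)) =
          fun w => (fun ζ => ∑' k, (conj a * ζ) ^ k / (firstMoment Ω k : ℂ)) (w 0) := by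
        ext w
        rw [hK1, Complex.conj_tsum]
        simp
      have hd' : DifferentiableOn ℂ (fun w => conj (K (Pi.single 0 a) w)) Ω := by
        rw [he]
        exact hd.comp (by fun_prop) fun w hw => h.apply_zero_mem_slice hw
      refine ⟨hd', MemLp.of_bound (hd'.continuousOn.aestronglyMeasurable h.isOpen.measurableSet)
        (∑' k, B ^ k / firstMoment Ω k) ?_⟩
      filter_upwards [ae_restrict_mem h.isOpen.measurableSet] with w hw
      rw [congrFun he w]
      exact tsum_of_norm_bounded hsum.hasSum fun k => hterm k _ (h.apply_zero_mem_slice hw)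
    · have := hG z hz
      simpa only [hK2 z hza, Complex.conj_conj] using this
  · by_cases hza : z = Pi.single 0 (z 0)
    · set a := z 0
      rw [hza] at hz ⊢
      obtain ⟨B, hB0, hB, hsum⟩ := h.exists_summable_pow_div_firstMoment hz
      have h0 := h.mem_slice_of_norm_le (ζ := 0) (by simp) hz
      have hi : IntegrableOn f Ω := hf.2.integrable (by norm_num)
      obtain ⟨b, hb, hab⟩ := h.exists_norm_lt_mem_slice hz
      have hdf : DifferentiableOn ℂ (fun ζ => f (Pi.single 0 ζ)) (ball 0 ‖b‖) :=
        hf.1.comp differentiable_single_zero.differentiableOn fun ζ hζ =>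
          h.mem_slice_of_norm_le (mem_ball_zero_iff.1 hζ).le hb
      have ht := Complex.hasSum_taylorSeries_on_ball hdf (z := a) (by simpa using hab)
      have hFi : ∀ k : ℕ, Integrable (fun w : Fin (m + 1) → ℂ =>
          f w * ((a * conj (w 0)) ^ k / (firstMoment Ω k : ℂ))) (volume.restrict Ω) ∧
          ∫ w in Ω, ‖f w * ((a * conj (w 0)) ^ k / (firstMoment Ω k : ℂ))‖ ≤
            (∫ w in Ω, ‖f w‖) * (B ^ k / firstMoment Ω k) := by
        intro k
        have hpos := h.firstMoment_pos h0 k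
        have hbd : ∀ w ∈ Ω, ‖(a * conj (w 0)) ^ k / (firstMoment Ω k : ℂ)‖ ≤
            B ^ k / firstMoment Ω k := by
          intro w hw
          rw [norm_div, norm_pow, norm_mul, RCLike.norm_conj, Complex.norm_real,
            Real.norm_of_nonneg hpos.le]
          have := hB _ hw
          gcongr
        have hI : Integrable (fun w : Fin (m + 1) → ℂ =>
            f w * ((a * conj (w 0)) ^ k / (firstMoment Ω k : ℂ))) (volume.restrict Ω) := by
          refine Integrable.mul_bdd (c := B ^ k / firstMoment Ω k) hi
            (Continuous.aestronglyMeasurable (by fun_prop)) ?_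
          filter_upwards [ae_restrict_mem h.isOpen.measurableSet] with w hw using hbd w hw
        refine ⟨hI, ?_⟩
        rw [← integral_mul_const]
        refine setIntegral_mono_on hI.norm (hi.norm.mul_const _) h.isOpen.measurableSet
          fun w hw => ?_
        rw [norm_mul]
        gcongr
        exact hbd w hw
      have hs := hasSum_integral_of_summable_integral_norm (fun k => (hFi k).1)
        (Summable.of_nonneg_of_le (fun k => integral_nonneg fun w => norm_nonneg _)
          (fun k => (hFi k).2) (hsum.mul_left _))
      have hterm : ∀ k : ℕ, ∫ w in Ω, f w * ((a * conj (w 0)) ^ k / (firstMoment Ω k : ℂ)) =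
          (k.factorial : ℂ)⁻¹ • (a - 0) ^ k •
            iteratedDeriv k (fun ζ => f (Pi.single 0 ζ)) 0 := by
        intro k
        have hpos : (firstMoment Ω k : ℂ) ≠ 0 :=
          Complex.ofReal_ne_zero.2 (h.firstMoment_pos h0 k).ne'
        have h1 := h.integral_mul_conj_pow hf.1 hi k
        have h2 : ∀ w : Fin (m + 1) → ℂ, f w * ((a * conj (w 0)) ^ k / (firstMoment Ω k : ℂ)) =
            (a ^ k / (firstMoment Ω k : ℂ)) * (f w * conj (w 0) ^ k) := by
          intro w
          rw [mul_pow]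
          ring
        simp only [h2]
        rw [integral_const_mul, h1, smul_eq_mul, smul_eq_mul, sub_zero]
        field_simp
      simp only [hterm] at hs
      rw [hs.unique ht |>.symm]
      refine integral_congr_ae (ae_of_all _ fun w => ?_)
      simp only [hK1]
      exact tsum_mul_left
    · simp only [hK2 z hza]
      exact hGr z hz f hf

end IsCompleteReinhardtInCylinder

/-! ### Smoothed seminorms and their Hessians -/

section SmoothedNorm

variable {E F : Type*} [NormedAddCommGroup E] [NormedSpace ℝ E] [NormedAddCommGroup F]
  [InnerProductSpace ℝ F]

/-- A smooth convex perturbation of the seminorm `‖L x‖`. -/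
noncomputable def smoothedNorm (ε : ℝ) (L : E →L[ℝ] F) (x : E) : ℝ := √(ε ^ 2 + ‖L x‖ ^ 2)

variable {ε : ℝ} (L : E →L[ℝ] F)

theorem smoothedNorm_pos (hε : 0 < ε) (x : E) : 0 < smoothedNorm ε L x :=
  Real.sqrt_pos.2 (by positivity)

theorem sq_smoothedNorm (x : E) : smoothedNorm ε L x ^ 2 = ε ^ 2 + ‖L x‖ ^ 2 :=
  Real.sq_sqrt (by positivity)

theorem norm_le_smoothedNorm (x : E) : ‖L x‖ ≤ smoothedNorm ε L x :=
  Real.le_sqrt_of_sq_le (by nlinarith [sq_nonneg ε])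

theorem smoothedNorm_le_smoothedNorm {δ : ℝ} (hδ : 0 ≤ δ) (hδε : δ ≤ ε) {x y : E}
    (h : ‖L x‖ ≤ ‖L y‖) : smoothedNorm δ L x ≤ smoothedNorm ε L y :=
  Real.sqrt_le_sqrt (by gcongr)

theorem contDiff_smoothedNorm (hε : 0 < ε) {k : WithTop ℕ∞} :
    ContDiff ℝ k (smoothedNorm ε L) := by
  rw [contDiff_iff_contDiffAt]
  intro x
  refine ContDiffAt.sqrt ?_ (by positivity)
  exact (contDiff_const.add ((contDiff_norm_sq ℝ).comp L.contDiff)).contDiffAt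

theorem hasFDerivAt_smoothedNorm (hε : 0 < ε) (x : E) :
    HasFDerivAt (smoothedNorm ε L)
      ((smoothedNorm ε L x)⁻¹ • (innerSL ℝ (L x)).comp L) x := by
  have h1 : HasFDerivAt (fun x => ε ^ 2 + ‖L x‖ ^ 2) (2 • (innerSL ℝ (L x)).comp L) x :=
    (L.hasFDerivAt.norm_sq).const_add _
  have h2 := h1.sqrt (by positivity)
  refine h2.congr_fderiv ?_
  have h0 : √(ε ^ 2 + ‖L x‖ ^ 2) ≠ 0 := (smoothedNorm_pos L hε x).ne'
  rw [smoothedNorm, ← Nat.cast_smul_eq_nsmul ℝ, smul_smul]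
  congr 1
  field_simp
  norm_num

theorem fderiv_fderiv_smoothedNorm_apply (hε : 0 < ε) (x v : E) :
    fderiv ℝ (fderiv ℝ (smoothedNorm ε L)) x v v =
      (smoothedNorm ε L x ^ 2 * ‖L v‖ ^ 2 - inner ℝ (L x) (L v) ^ 2) / smoothedNorm ε L x ^ 3 := by
  have hpos := smoothedNorm_pos L hε x
  have h1 : DifferentiableAt ℝ (fderiv ℝ (smoothedNorm ε L)) x :=
    ((contDiff_smoothedNorm L hε (k := 2)).fderiv_right (m := 1) (by norm_num)).differentiable
      (by norm_num) x
  have h2 := h1.hasFDerivAt.clm_apply (hasFDerivAt_const v x)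
  have h3 : (fun y => fderiv ℝ (smoothedNorm ε L) y v) =
      fun y => (smoothedNorm ε L y)⁻¹ * inner ℝ (L v) (L y) := by
    ext y
    rw [(hasFDerivAt_smoothedNorm L hε y).fderiv]
    simp [real_inner_comm]
  rw [h3] at h2
  have h4 : HasFDerivAt (fun y => inner ℝ (L v) (L y)) ((innerSL ℝ (L v)).comp L) x :=
    ((innerSL ℝ (L v)).comp L).hasFDerivAt
  have h5 := ((hasDerivAt_inv hpos.ne').comp_hasFDerivAt x
    (hasFDerivAt_smoothedNorm L hε x)).mul h4
  have h6 := congrArg (fun A : E →L[ℝ] ℝ => A v) (h2.unique h5)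
  simp only [Function.comp_apply, _root_.add_apply, _root_.smul_apply,
    ContinuousLinearMap.comp_apply, innerSL_apply_apply, ContinuousLinearMap.flip_apply,
    _root_.zero_apply, map_zero, zero_add, smul_eq_mul] at h6
  rw [h6, real_inner_comm (L x) (L v), real_inner_self_eq_norm_sq]
  field_simp
  ring

/-- By Cauchy–Schwarz the term `‖L x‖² * ‖L v‖²` absorbs the squared inner product; the smoothing
contributes the surviving `ε² * ‖L v‖²`, even in the radial direction. -/
theorem fderiv_fderiv_smoothedNorm_lower (hε : 0 < ε) (x v : E) :
    ε ^ 2 * ‖L v‖ ^ 2 / smoothedNorm ε L x ^ 3 ≤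
      fderiv ℝ (fderiv ℝ (smoothedNorm ε L)) x v v := by
  have hpos := smoothedNorm_pos L hε x
  rw [fderiv_fderiv_smoothedNorm_apply L hε, sq_smoothedNorm]
  have h := abs_real_inner_le_norm (L x) (L v)
  have h2 : inner ℝ (L x) (L v) ^ 2 ≤ (‖L x‖ * ‖L v‖) ^ 2 := sq_le_sq' (abs_le.1 h).1 (abs_le.1 h).2
  gcongr
  nlinarith

/-- This function is the Euclidean norm of `(ε, L x)`, a norm composed with an affine map. -/
theorem convexOn_smoothedNorm : ConvexOn ℝ univ (smoothedNorm ε L) := by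
  let A : E →ₗ[ℝ] WithLp 2 (ℝ × F) :=
    (WithLp.linearEquiv 2 ℝ (ℝ × F)).symm.toLinearMap ∘ₗ LinearMap.inr ℝ ℝ F ∘ₗ L.toLinearMap
  have h := ((convexOn_univ_norm (E := WithLp 2 (ℝ × F))).translate_right
    (WithLp.toLp 2 (ε, (0 : F)))).comp_linearMap A
  rw [preimage_univ, preimage_univ] at h
  convert h using 1
  ext x
  simp only [Function.comp_apply, WithLp.prod_norm_eq_of_L2, smoothedNorm]
  simp [A]

end SmoothedNorm

/-! ### The smoothed domains: Reinhardt, analytic, strongly convex -/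

/-- The coordinates with positive index, as a map to Euclidean space. -/
noncomputable def tailMap (m : ℕ) : (Fin (m + 1) → ℂ) →L[ℝ] PiLp 2 (fun _ : Fin m => ℂ) :=
  (PiLp.continuousLinearEquiv 2 ℝ (fun _ : Fin m => ℂ)).symm.toContinuousLinearMap.comp
    (ContinuousLinearMap.pi fun j => ContinuousLinearMap.proj j.succ)

/-- The first coordinate. -/
noncomputable def headMap (m : ℕ) : (Fin (m + 1) → ℂ) →L[ℝ] ℂ := ContinuousLinearMap.proj 0

theorem headMap_apply {m : ℕ} (z : Fin (m + 1) → ℂ) : headMap m z = z 0 := rfl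

theorem tailMap_apply {m : ℕ} (z : Fin (m + 1) → ℂ) (j : Fin m) : tailMap m z j = z j.succ := rfl

theorem norm_tailMap_le_norm_tailMap {m : ℕ} {z w : Fin (m + 1) → ℂ}
    (h : ∀ j : Fin m, ‖z j.succ‖ ≤ ‖w j.succ‖) : ‖tailMap m z‖ ≤ ‖tailMap m w‖ := by
  rw [PiLp.norm_eq_of_L2, PiLp.norm_eq_of_L2]
  refine Real.sqrt_le_sqrt (Finset.sum_le_sum fun j _ => ?_)
  exact pow_le_pow_left₀ (norm_nonneg _) (h j) 2

theorem norm_le_norm_tailMap {m : ℕ} (z : Fin (m + 1) → ℂ) (j : Fin m) :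
    ‖z j.succ‖ ≤ ‖tailMap m z‖ := PiLp.norm_apply_le (tailMap m z) j

/-- A defining function of `smoothedDomain`. -/
noncomputable def smoothedDefiningFunction (m : ℕ) (ε : ℝ) (z : Fin (m + 1) → ℂ) : ℝ :=
  smoothedNorm ε (headMap m) z + smoothedNorm ε (tailMap m) z - 1

/-- A smooth strongly convex domain that exhausts `‖z₀‖ + ‖(z₁, …, zₘ)‖ < 1` as `ε → 0`. -/
def smoothedDomain (m : ℕ) (ε : ℝ) : Set (Fin (m + 1) → ℂ) :=
  {z | smoothedDefiningFunction m ε z < 0}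

variable {m : ℕ} {ε : ℝ}

theorem contDiff_smoothedDefiningFunction (hε : 0 < ε) {k : WithTop ℕ∞} :
    ContDiff ℝ k (smoothedDefiningFunction m ε) :=
  ((contDiff_smoothedNorm _ hε).add (contDiff_smoothedNorm _ hε)).sub contDiff_const

theorem smoothedDefiningFunction_mono {δ : ℝ} (hδ : 0 ≤ δ) (hδε : δ ≤ ε)
    {z w : Fin (m + 1) → ℂ} (h : ∀ j, ‖z j‖ ≤ ‖w j‖) :
    smoothedDefiningFunction m δ z ≤ smoothedDefiningFunction m ε w :=
  sub_le_sub_right (add_le_add (smoothedNorm_le_smoothedNorm _ hδ hδε (h 0))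
    (smoothedNorm_le_smoothedNorm _ hδ hδε (norm_tailMap_le_norm_tailMap fun j => h j.succ))) 1

theorem convexOn_smoothedDefiningFunction :
    ConvexOn ℝ univ (smoothedDefiningFunction m ε) :=
  ((convexOn_smoothedNorm _).add (convexOn_smoothedNorm _)).sub (concaveOn_const 1 convex_univ)

theorem convex_smoothedDomain : Convex ℝ (smoothedDomain m ε) := by
  have := (convexOn_smoothedDefiningFunction (m := m) (ε := ε)).convex_lt 0
  simpa [smoothedDomain] using this

theorem smoothedDefiningFunction_zero (hε : 0 ≤ ε) :
    smoothedDefiningFunction m ε 0 = 2 * ε - 1 := by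
  simp [smoothedDefiningFunction, smoothedNorm, Real.sqrt_sq hε]
  ring

theorem zero_mem_smoothedDomain (hε : 0 ≤ ε) (hε2 : ε < 1 / 2) : 0 ∈ smoothedDomain m ε := by
  rw [smoothedDomain, mem_ofPred_eq, smoothedDefiningFunction_zero hε]
  linarith

theorem norm_apply_lt_one_of_mem_smoothedDomain {z : Fin (m + 1) → ℂ}
    (hz : z ∈ smoothedDomain m ε) (j : Fin (m + 1)) : ‖z j‖ < 1 := by
  rw [smoothedDomain, mem_ofPred_eq, smoothedDefiningFunction] at hz
  have h1 := norm_le_smoothedNorm (ε := ε) (headMap m) z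
  have h2 := norm_le_smoothedNorm (ε := ε) (tailMap m) z
  have h3 := norm_nonneg (headMap m z)
  have h4 := norm_nonneg (tailMap m z)
  refine Fin.cases ?_ (fun j => ?_) j
  · rw [headMap_apply] at h1
    linarith
  · have := norm_le_norm_tailMap z j
    linarith

theorem continuous_smoothedDefiningFunction : Continuous (smoothedDefiningFunction m ε) := by
  unfold smoothedDefiningFunction smoothedNorm
  fun_prop

theorem isOpen_smoothedDomain : IsOpen (smoothedDomain m ε) :=
  isOpen_lt continuous_smoothedDefiningFunction continuous_const

theorem smoothedDomain_isCompleteReinhardt (hε : 0 ≤ ε) :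
    IsCompleteReinhardtInCylinder (smoothedDomain m ε) where
  isOpen := isOpen_smoothedDomain
  isBounded := by
    refine (isBounded_iff_forall_norm_le).2 ⟨1, fun z hz => ?_⟩
    exact (pi_norm_le_iff_of_nonneg zero_le_one).2 fun j =>
      (norm_apply_lt_one_of_mem_smoothedDomain hz j).le
  mul_mem c hc z hz := by
    refine lt_of_le_of_lt (smoothedDefiningFunction_mono hε le_rfl fun j => ?_) hz
    rw [norm_mul]
    exact mul_le_of_le_one_left (norm_nonneg _) (hc j)
  norm_le z hz := (norm_apply_lt_one_of_mem_smoothedDomain hz 0).le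

theorem isDomainInCn_smoothedDomain (hε : 0 ≤ ε) (hε2 : ε < 1 / 2) :
    IsDomainInCn (smoothedDomain m ε) :=
  ⟨isOpen_smoothedDomain, ⟨0, zero_mem_smoothedDomain hε hε2⟩,
    convex_smoothedDomain.isPreconnected⟩

/-- A zero `z` of the defining function is the limit of `t • z` as `t` increases to `1`, and
convexity bounds the value at `t • z` by `(1 - t) * (2 * ε - 1) < 0`. -/
theorem frontier_smoothedDomain (hε : 0 ≤ ε) (hε2 : ε < 1 / 2) :
    frontier (smoothedDomain m ε) = {z | smoothedDefiningFunction m ε z = 0} := by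
  refine Subset.antisymm
    (frontier_lt_subset_eq continuous_smoothedDefiningFunction continuous_const) fun z hz => ?_
  rw [mem_ofPred_eq] at hz
  rw [isOpen_smoothedDomain.frontier_eq]
  refine ⟨?_, fun h => (h : smoothedDefiningFunction m ε z < 0).ne hz⟩
  have h0 := smoothedDefiningFunction_zero (m := m) hε
  have hmem : ∀ t ∈ Ioo (0 : ℝ) 1, t • z ∈ smoothedDomain m ε := by
    intro t ht
    have h := (convexOn_smoothedDefiningFunction (m := m) (ε := ε)).2 (mem_univ z) (mem_univ 0)
      ht.1.le (sub_nonneg.2 ht.2.le) (by ring)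
    rw [smul_zero, add_zero, hz, h0, smul_zero, zero_add, smul_eq_mul] at h
    refine h.trans_lt ?_
    nlinarith [ht.2]
  have hlim : Tendsto (fun t : ℝ => t • z) (𝓝[<] 1) (𝓝 z) := by
    have : Tendsto (fun t : ℝ => t • z) (𝓝 1) (𝓝 ((1 : ℝ) • z)) :=
      (continuous_id.smul continuous_const).tendsto 1
    rw [one_smul] at this
    exact this.mono_left nhdsWithin_le_nhds
  exact mem_closure_of_tendsto hlim
    (by filter_upwards [Ioo_mem_nhdsLT zero_lt_one] with t ht using hmem t ht)

theorem eq_zero_of_headMap_tailMap {z : Fin (m + 1) → ℂ} (h1 : headMap m z = 0)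
    (h2 : tailMap m z = 0) : z = 0 := by
  ext j
  refine Fin.cases h1 (fun j => ?_) j
  rw [← tailMap_apply z j, h2]
  rfl

theorem fderiv_smoothedDefiningFunction (hε : 0 < ε) :
    fderiv ℝ (smoothedDefiningFunction m ε) =
      fun z => fderiv ℝ (smoothedNorm ε (headMap m)) z + fderiv ℝ (smoothedNorm ε (tailMap m)) z := by
  ext1 z
  have h1 := (contDiff_smoothedNorm (headMap m) hε (k := 1)).differentiable (by norm_num) z
  have h2 := (contDiff_smoothedNorm (tailMap m) hε (k := 1)).differentiable (by norm_num) z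
  exact ((h1.hasFDerivAt.add h2.hasFDerivAt).sub_const 1).fderiv

/-- Applied to `z` itself, the derivative is a positive combination of `‖headMap m z‖²` and
`‖tailMap m z‖²`. -/
theorem fderiv_smoothedDefiningFunction_ne_zero (hε : 0 < ε) {z : Fin (m + 1) → ℂ} (hz : z ≠ 0) :
    fderiv ℝ (smoothedDefiningFunction m ε) z ≠ 0 := by
  intro h
  have h1 := congrArg (fun A : (Fin (m + 1) → ℂ) →L[ℝ] ℝ => A z) h
  simp only [fderiv_smoothedDefiningFunction hε, (hasFDerivAt_smoothedNorm _ hε z).fderiv,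
    _root_.add_apply, _root_.smul_apply,
    ContinuousLinearMap.comp_apply, innerSL_apply_apply, real_inner_self_eq_norm_sq,
    _root_.zero_apply, smul_eq_mul] at h1
  have p1 := smoothedNorm_pos (headMap m) hε z
  have p2 := smoothedNorm_pos (tailMap m) hε z
  obtain ⟨e1, e2⟩ := (add_eq_zero_iff_of_nonneg (by positivity) (by positivity)).1 h1
  refine hz (eq_zero_of_headMap_tailMap ?_ ?_)
  · simpa [p1.ne'] using e1
  · simpa [p2.ne'] using e2

/-- Each summand is positive off the kernel of its linear map, and the two kernels meet only in `0`.
Positivity thus holds in every direction, not only the tangential ones. -/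
theorem fderiv_fderiv_smoothedDefiningFunction_pos (hε : 0 < ε) (z : Fin (m + 1) → ℂ)
    {v : Fin (m + 1) → ℂ} (hv : v ≠ 0) :
    0 < fderiv ℝ (fderiv ℝ (smoothedDefiningFunction m ε)) z v v := by
  have h1 : DifferentiableAt ℝ (fderiv ℝ (smoothedNorm ε (headMap m))) z :=
    ((contDiff_smoothedNorm _ hε (k := 2)).fderiv_right (m := 1) (by norm_num)).differentiable
      (by norm_num) z
  have h2 : DifferentiableAt ℝ (fderiv ℝ (smoothedNorm ε (tailMap m))) z :=
    ((contDiff_smoothedNorm _ hε (k := 2)).fderiv_right (m := 1) (by norm_num)).differentiable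
      (by norm_num) z
  rw [fderiv_smoothedDefiningFunction hε, fderiv_fun_add h1 h2, _root_.add_apply,
    _root_.add_apply]
  have l1 := fderiv_fderiv_smoothedNorm_lower (headMap m) hε z v
  have l2 := fderiv_fderiv_smoothedNorm_lower (tailMap m) hε z v
  have p1 := smoothedNorm_pos (headMap m) hε z
  have p2 := smoothedNorm_pos (tailMap m) hε z
  refine lt_of_lt_of_le ?_ (add_le_add l1 l2)
  by_cases hh : headMap m v = 0
  · have ht : tailMap m v ≠ 0 := fun ht => hv (eq_zero_of_headMap_tailMap hh ht)
    have := norm_pos_iff.2 ht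
    positivity
  · have := norm_pos_iff.2 hh
    positivity

theorem isLocalDefiningFunction_smoothedDefiningFunction (hε : 0 < ε) (hε2 : ε < 1 / 2)
    (k : WithTop ℕ∞) {p : Fin (m + 1) → ℂ} (hp : p ∈ frontier (smoothedDomain m ε)) :
    IsLocalDefiningFunction k (smoothedDomain m ε) p {0}ᶜ (smoothedDefiningFunction m ε) where
  isOpen := isOpen_compl_singleton
  mem := by
    rintro rfl
    rw [frontier_smoothedDomain hε.le hε2, mem_ofPred_eq, smoothedDefiningFunction_zero hε.le] at hp
    linarith
  contDiffOn := (contDiff_smoothedDefiningFunction hε).contDiffOn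
  mem_iff _ _ := Iff.rfl
  mem_frontier_iff z _ := by rw [frontier_smoothedDomain hε.le hε2]; rfl
  fderiv_ne_zero _ hz := fderiv_smoothedDefiningFunction_ne_zero hε hz

theorem hasBoundaryOfClass_smoothedDomain (hε : 0 < ε) (hε2 : ε < 1 / 2) (k : WithTop ℕ∞) :
    HasBoundaryOfClass k (smoothedDomain m ε) := fun _ hp =>
  ⟨_, _, isLocalDefiningFunction_smoothedDefiningFunction hε hε2 k hp⟩

theorem isStronglyConvexDomain_smoothedDomain (hε : 0 < ε) (hε2 : ε < 1 / 2) :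
    IsStronglyConvexDomain (smoothedDomain m ε) :=
  ⟨convex_smoothedDomain, fun p hp =>
    ⟨_, _, isLocalDefiningFunction_smoothedDefiningFunction hε hε2 2 hp, fun _ hv _ =>
      fderiv_fderiv_smoothedDefiningFunction_pos hε p hv⟩⟩

theorem isReinhardt_smoothedDomain (hε : 0 ≤ ε) : IsReinhardt (smoothedDomain m ε) :=
  fun c hc z hz => (smoothedDomain_isCompleteReinhardt hε).mul_mem c (fun j => (hc j).le) z hz

/-! ### Moments of the limiting domain -/

theorem integral_pow_mul_one_sub_pow (p q : ℕ) :
    ∫ x in (0 : ℝ)..1, x ^ p * (1 - x) ^ q =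
      (p.factorial * q.factorial : ℝ) / (p + q + 1).factorial := by
  have h := Complex.betaIntegral_eq_Gamma_mul_div (p + 1) (q + 1) (by simp; positivity)
    (by simp; positivity)
  have e : (p + 1 + (q + 1) : ℂ) = ((p + q + 1 : ℕ) : ℂ) + 1 := by push_cast; ring
  rw [e, Complex.Gamma_nat_eq_factorial, Complex.Gamma_nat_eq_factorial,
    Complex.Gamma_nat_eq_factorial, Complex.betaIntegral] at h
  simp only [add_sub_cancel_right, Complex.cpow_natCast] at h
  have h2 : ∀ x : ℝ, (x : ℂ) ^ p * (1 - (x : ℂ)) ^ q = ((x ^ p * (1 - x) ^ q : ℝ) : ℂ) := by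
    intro x
    push_cast
    rfl
  simp only [h2] at h
  rw [intervalIntegral.integral_ofReal] at h
  rw [← Complex.ofReal_inj, h]
  push_cast
  rfl

theorem volume_real_norm_toLp_lt (m : ℕ) {ρ : ℝ} (hρ : 0 < ρ) :
    volume.real {y : Fin m → ℂ | ‖WithLp.toLp 2 y‖ < ρ} =
      ρ ^ (2 * m) * volume.real {y : Fin m → ℂ | ‖WithLp.toLp 2 y‖ < 1} := by
  have h : {y : Fin m → ℂ | ‖WithLp.toLp 2 y‖ < ρ} =
      ρ • {y : Fin m → ℂ | ‖WithLp.toLp 2 y‖ < 1} := by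
    ext y
    rw [mem_smul_set_iff_inv_smul_mem₀ hρ.ne', mem_ofPred_eq, mem_ofPred_eq, WithLp.toLp_smul,
      norm_smul, norm_inv, Real.norm_of_nonneg hρ.le, inv_mul_lt_iff₀ hρ, mul_one]
  have hd : Module.finrank ℝ (Fin m → ℂ) = 2 * m := by
    simp [Module.finrank_pi_fintype, Complex.finrank_real_complex, mul_comm]
  rw [h, Measure.real, Measure.addHaar_smul, hd, abs_of_nonneg (by positivity), ENNReal.toReal_mul,
    ENNReal.toReal_ofReal (by positivity), Measure.real]

theorem mem_smoothedDomain_zero_iff {m : ℕ} {z : Fin (m + 1) → ℂ} :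
    z ∈ smoothedDomain m 0 ↔ ‖z 0‖ + ‖WithLp.toLp 2 (fun j : Fin m => z j.succ)‖ < 1 := by
  have h : tailMap m z = WithLp.toLp 2 (fun j : Fin m => z j.succ) := rfl
  change smoothedDefiningFunction m 0 z < 0 ↔ _
  simp [smoothedDefiningFunction, smoothedNorm, Real.sqrt_sq (norm_nonneg _), h, headMap_apply]

/-- The fibre over `z₀` is a Euclidean ball of radius `1 - ‖z₀‖` in real dimension `2 * m`. Polar
coordinates in `z₀` leave a beta integral, hence a reciprocal binomial coefficient. -/
theorem exists_firstMoment_smoothedDomain_zero (m : ℕ) :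
    ∃ A > 0, ∀ k, firstMoment (smoothedDomain m 0) k =
      A / ((2 * k + 1 + (2 * m + 1)).choose (2 * m + 1) : ℝ) := by
  have hΩ := smoothedDomain_isCompleteReinhardt (m := m) le_rfl
  set V := volume.real {y : Fin m → ℂ | ‖WithLp.toLp 2 y‖ < 1}
  set P := volume.real (ball (0 : ℂ) 1)
  have key : ∀ k, firstMoment (smoothedDomain m 0) k =
      2 * P * V * ∫ x in (0 : ℝ)..1, x ^ (2 * k + 1) * (1 - x) ^ (2 * m) := by
    intro k
    have hmp := volume_preserving_piFinSuccAbove (fun _ : Fin (m + 1) => ℂ) 0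
    set e := MeasurableEquiv.piFinSuccAbove (fun _ : Fin (m + 1) => ℂ) 0
    let G : ℂ × (Fin m → ℂ) → ℝ := fun p =>
      {y : Fin m → ℂ | ‖WithLp.toLp 2 y‖ < 1 - ‖p.1‖}.indicator (fun _ => ‖p.1‖ ^ (2 * k)) p.2
    have hG : ∀ w, (smoothedDomain m 0).indicator (fun w => ‖w 0‖ ^ (2 * k)) w = G (e w) := by
      intro w
      have h1 : (e w).1 = w 0 := rfl
      have h2 : (e w).2 = fun j : Fin m => w j.succ := rfl
      simp only [G, h1, h2]
      by_cases hw : w ∈ smoothedDomain m 0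
      · rw [indicator_of_mem hw, indicator_of_mem]
        exact lt_sub_iff_add_lt'.2 (mem_smoothedDomain_zero_iff.1 hw)
      · rw [indicator_of_notMem hw, indicator_of_notMem]
        exact fun h => hw (mem_smoothedDomain_zero_iff.2 (lt_sub_iff_add_lt'.1 h))
    have hint : Integrable G := by
      rw [← hmp.integrable_comp_emb e.measurableEmbedding]
      have h3 := (integrable_indicator_iff isOpen_smoothedDomain.measurableSet).2
        (hΩ.integrableOn_norm_pow (2 * k))
      exact h3.congr (ae_of_all _ hG)
    have h4 : firstMoment (smoothedDomain m 0) k = ∫ p, G p := by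
      rw [firstMoment, ← integral_indicator isOpen_smoothedDomain.measurableSet,
        ← hmp.integral_comp e.measurableEmbedding]
      exact integral_congr_ae (ae_of_all _ hG)
    have hmeas : ∀ ρ : ℝ, MeasurableSet {y : Fin m → ℂ | ‖WithLp.toLp 2 y‖ < ρ} := fun ρ =>
      (isOpen_lt (by fun_prop) continuous_const).measurableSet
    let φ : ℝ → ℝ := (Ioo (0 : ℝ) 1).indicator fun x => x ^ (2 * k) * ((1 - x) ^ (2 * m) * V)
    have h5 : ∀ᵐ ζ : ℂ, ∫ y, G (ζ, y) = φ ‖ζ‖ := by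
      -- The point `0` is discarded because `φ`, supported in the open interval, vanishes there
      -- although the fibre over `0` need not be null.
      filter_upwards [compl_mem_ae_iff.2 (measure_singleton (0 : ℂ))] with ζ hζ
      have hζ0 : 0 < ‖ζ‖ := norm_pos_iff.2 hζ
      simp only [G]
      rw [integral_indicator (hmeas _), setIntegral_const, smul_eq_mul, mul_comm]
      by_cases h1 : ‖ζ‖ < 1
      · rw [volume_real_norm_toLp_lt m (sub_pos.2 h1)]
        simp [φ, V, h1, norm_pos_iff.1 hζ0]
      · have h6 : {y : Fin m → ℂ | ‖WithLp.toLp 2 y‖ < 1 - ‖ζ‖} = ∅ := by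
          refine eq_empty_of_forall_notMem fun y hy => ?_
          rw [mem_ofPred_eq] at hy
          linarith [norm_nonneg (WithLp.toLp 2 y)]
        rw [h6, measureReal_empty, mul_zero]
        simp [φ, h1]
    rw [h4, Measure.volume_eq_prod, integral_prod _ hint, integral_congr_ae h5,
      integral_fun_norm_addHaar volume φ, Complex.finrank_real_complex]
    have h7 : ∀ y : ℝ, y ^ (2 - 1) • φ y = (Ioo (0 : ℝ) 1).indicator
        (fun x => V * (x ^ (2 * k + 1) * (1 - x) ^ (2 * m))) y := by
      intro y
      by_cases hy : y ∈ Ioo (0 : ℝ) 1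
      · simp only [φ, indicator_of_mem hy, smul_eq_mul]
        ring
      · simp [φ, indicator_of_notMem hy]
    simp only [h7]
    rw [setIntegral_indicator measurableSet_Ioo, inter_eq_right.2 Ioo_subset_Ioi_self,
      integral_const_mul, intervalIntegral.integral_of_le zero_le_one, integral_Ioc_eq_integral_Ioo]
    simp only [smul_eq_mul, nsmul_eq_mul]
    push_cast
    ring
  have hform : ∀ k, firstMoment (smoothedDomain m 0) k = (2 * P * V / (2 * m + 1)) /
      ((2 * k + 1 + (2 * m + 1)).choose (2 * m + 1) : ℝ) := by
    intro k
    rw [key, integral_pow_mul_one_sub_pow, ← Nat.choose_symm_add, Nat.cast_add_choose,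
      Nat.factorial_succ (2 * m), show 2 * k + 1 + (2 * m + 1) = 2 * k + 1 + 2 * m + 1 by ring]
    have h1 : ((2 * k + 1 + 2 * m + 1).factorial : ℝ) ≠ 0 := by positivity
    have h2 : ((2 * k + 1).factorial : ℝ) ≠ 0 := by positivity
    have h3 : ((2 * m).factorial : ℝ) ≠ 0 := by positivity
    push_cast
    field_simp
  -- Positivity of the constant is read off from positivity of the zeroth moment.
  refine ⟨_, ?_, hform⟩
  have h0 := hΩ.firstMoment_pos (by
    simpa [firstAxisSlice] using zero_mem_smoothedDomain (m := m) le_rfl (by norm_num)) 0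
  rw [hform 0] at h0
  exact (div_pos_iff_of_pos_right (by exact_mod_cast Nat.choose_pos (by omega))).1 h0

/-! ### Sign of the limiting kernel -/

/-- In the binomial series of `(1 - r)^(-(2m+2))` at `r = iσ` the even powers are real and the odd
ones imaginary, so the imaginary part keeps exactly the odd terms. -/
theorem hasSum_choose_mul_neg_sq_pow (m : ℕ) {σ : ℝ} (hσ : 0 < σ) (hσ1 : σ < 1) :
    HasSum (fun k : ℕ => ((2 * k + 1 + (2 * m + 1)).choose (2 * m + 1) : ℝ) * (-σ ^ 2) ^ k)
      (σ⁻¹ * (1 / (1 - σ * Complex.I) ^ (2 * m + 2)).im) := by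
  have h := hasSum_choose_mul_geometric_of_norm_lt_one (𝕜 := ℂ) (2 * m + 1) (r := σ * Complex.I)
    (by simpa [abs_of_pos hσ] using hσ1)
  have h2 := (Complex.hasSum_im h).mul_left σ⁻¹
  have hpow : ∀ k, ((σ : ℂ) * Complex.I) ^ (2 * k) = (((-σ ^ 2) ^ k : ℝ) : ℂ) := by
    intro k
    rw [pow_mul, mul_pow, Complex.I_sq]
    push_cast
    ring
  rw [← (show Function.Injective fun k : ℕ => 2 * k + 1 from
    fun a b hab => by simpa using hab).hasSum_iff] at h2
  · refine h2.congr_fun ?_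
    intro k
    have h3 : (((2 * k + 1 + (2 * m + 1)).choose (2 * m + 1) : ℕ) : ℂ) *
        ((σ : ℂ) * Complex.I) ^ (2 * k + 1) =
        (((2 * k + 1 + (2 * m + 1)).choose (2 * m + 1) * ((-σ ^ 2) ^ k * σ) : ℝ) : ℂ) *
          Complex.I := by
      rw [pow_succ _ (2 * k), hpow]
      push_cast
      ring
    simp only [Function.comp_apply]
    rw [h3, Complex.im_ofReal_mul, Complex.I_im]
    field_simp
  · intro j hj
    obtain ⟨i, rfl⟩ : ∃ i, j = 2 * i := by
      rcases Nat.even_or_odd' j with ⟨i, rfl | rfl⟩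
      · exact ⟨i, rfl⟩
      · exact absurd ⟨i, rfl⟩ hj
    rw [hpow, ← Complex.ofReal_natCast, ← Complex.ofReal_mul, Complex.ofReal_im, mul_zero]

/-- For `m ≥ 2` the kernel function of the limiting domain takes negative values. -/
theorem exists_tsum_choose_mul_neg {m : ℕ} (hm : 2 ≤ m) :
    ∃ σ : ℝ, 0 < σ ∧ σ < 1 ∧
      ∑' k : ℕ, ((2 * k + 1 + (2 * m + 1)).choose (2 * m + 1) : ℝ) * (-σ ^ 2) ^ k < 0 := by
  -- This makes `(2 * m + 2) * θ = 6π/5`, just beyond `π`; `θ < π/4` amounts to `12 < 5 * (m + 1)`,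
  -- true for `m ≥ 2`.
  set θ : ℝ := 3 * Real.pi / (5 * (m + 1))
  have hm' : (2 : ℝ) ≤ m := by exact_mod_cast hm
  have hπ := Real.pi_pos
  have hθ0 : 0 < θ := by positivity
  have hθ1 : θ < Real.pi / 4 := by
    rw [div_lt_div_iff₀ (by positivity) (by positivity)]
    nlinarith
  have hcos : 0 < Real.cos θ := Real.cos_pos_of_mem_Ioo ⟨by linarith, by linarith⟩
  have hσ0 : 0 < Real.tan θ := Real.tan_pos_of_pos_of_lt_pi_div_two hθ0 (by linarith)
  have hσ1 : Real.tan θ < 1 := by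
    rw [← Real.tan_pi_div_four]
    exact Real.tan_lt_tan_of_nonneg_of_lt_pi_div_two hθ0.le (by linarith) hθ1
  refine ⟨Real.tan θ, hσ0, hσ1, ?_⟩
  rw [(hasSum_choose_mul_neg_sq_pow m hσ0 hσ1).tsum_eq]
  refine mul_neg_of_pos_of_neg (by positivity) ?_
  -- The identity rests on `1 - i tan θ = exp (-iθ) / cos θ`.
  have h1 : 1 / (1 - (Real.tan θ : ℂ) * Complex.I) ^ (2 * m + 2) =
      ((Real.cos θ ^ (2 * m + 2) : ℝ) : ℂ) * Complex.exp (((2 * m + 2) * θ : ℝ) * Complex.I) := by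
    have h2 : (1 - (Real.tan θ : ℂ) * Complex.I) * Real.cos θ = Complex.exp (-(θ * Complex.I)) := by
      rw [← neg_mul, Complex.exp_mul_I, Complex.cos_neg, Complex.sin_neg, Real.tan_eq_sin_div_cos]
      have : (Complex.cos θ) ≠ 0 := by
        rw [← Complex.ofReal_cos]
        exact_mod_cast hcos.ne'
      push_cast
      field_simp
      ring
    have h3 : Complex.exp (((2 * m + 2) * θ : ℝ) * Complex.I) =
        Complex.exp (θ * Complex.I) ^ (2 * m + 2) := by
      rw [← Complex.exp_nat_mul]
      push_cast
      ring_nf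
    have h4 : (1 - (Real.tan θ : ℂ) * Complex.I) * Real.cos θ * Complex.exp (θ * Complex.I) = 1 := by
      rw [h2, ← Complex.exp_add, neg_add_cancel, Complex.exp_zero]
    have h5 : (1 - (Real.tan θ : ℂ) * Complex.I) ≠ 0 := fun h => by
      rw [h, zero_mul, zero_mul] at h4
      exact zero_ne_one h4
    rw [h3, div_eq_iff (pow_ne_zero _ h5)]
    push_cast
    push_cast at h4
    rw [← mul_pow, ← mul_pow, mul_comm, ← mul_assoc, h4, one_pow]
  rw [h1, Complex.im_ofReal_mul, Complex.exp_ofReal_mul_I_im]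
  refine mul_neg_of_pos_of_neg (by positivity) ?_
  have h6 : (2 * m + 2) * θ = Real.pi / 5 + Real.pi := by
    simp only [θ]
    field_simp
    ring
  rw [h6, Real.sin_add_pi, neg_lt_zero]
  exact Real.sin_pos_of_pos_of_lt_pi (by positivity) (by linarith)

/-! ### Passage from the limiting domain to small `ε` -/

theorem smoothedDomain_anti {m : ℕ} {δ ε : ℝ} (hδ : 0 ≤ δ) (hδε : δ ≤ ε) :
    smoothedDomain m ε ⊆ smoothedDomain m δ := fun _ hz =>
  (smoothedDefiningFunction_mono hδ hδε fun _ => le_rfl).trans_lt hz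

theorem tendsto_firstMoment_smoothedDomain (m k : ℕ) {u : ℕ → ℝ} (hu : Antitone u)
    (hpos : ∀ j, 0 < u j) (hlim : Tendsto u atTop (𝓝 0)) :
    Tendsto (fun j => firstMoment (smoothedDomain m (u j)) k) atTop
      (𝓝 (firstMoment (smoothedDomain m 0) k)) := by
  have hU : ⋃ j, smoothedDomain m (u j) = smoothedDomain m 0 := by
    refine Subset.antisymm (iUnion_subset fun j => smoothedDomain_anti le_rfl (hpos j).le) ?_
    intro z hz
    have hc : Continuous fun ε : ℝ => smoothedDefiningFunction m ε z := by
      unfold smoothedDefiningFunction smoothedNorm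
      fun_prop
    have h1 := ((hc.tendsto 0).comp hlim).eventually_lt_const
      (show smoothedDefiningFunction m 0 z < 0 from hz)
    obtain ⟨j, hj⟩ := h1.exists
    exact mem_iUnion.2 ⟨j, hj⟩
  have h := tendsto_setIntegral_of_monotone (μ := volume)
    (f := fun w : Fin (m + 1) → ℂ => ‖w 0‖ ^ (2 * k))
    (fun j => (isOpen_smoothedDomain (m := m) (ε := u j)).measurableSet)
    (fun i j hij => smoothedDomain_anti (hpos j).le (hu hij))
    (by rw [hU]; exact (smoothedDomain_isCompleteReinhardt le_rfl).integrableOn_norm_pow _)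
  rwa [hU] at h

theorem ofReal_mem_firstAxisSlice_smoothedDomain_zero {m : ℕ} {σ : ℝ} (hσ : 0 < σ) (hσ1 : σ < 1) :
    (σ : ℂ) ∈ firstAxisSlice (smoothedDomain m 0) := by
  change (Pi.single 0 (σ : ℂ) : Fin (m + 1) → ℂ) ∈ smoothedDomain m 0
  rw [mem_smoothedDomain_zero_iff]
  have : (fun j : Fin m => (Pi.single 0 (σ : ℂ) : Fin (m + 1) → ℂ) j.succ) = 0 := by
    ext j
    simp
  rw [this]
  simpa [abs_of_pos hσ] using hσ1

/-- For `m ≥ 2` and small `ε`, the kernel function takes a negative value on the first axis. -/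
theorem exists_smoothedDomain_tsum_neg {m : ℕ} (hm : 2 ≤ m) :
    ∃ ε σ : ℝ, 0 < ε ∧ ε < 1 / 2 ∧ 0 < σ ∧ (σ : ℂ) ∈ firstAxisSlice (smoothedDomain m ε) ∧
      ∑' k, (-σ ^ 2) ^ k / firstMoment (smoothedDomain m ε) k < 0 := by
  obtain ⟨σ, hσ0, hσ1, hneg⟩ := exists_tsum_choose_mul_neg hm
  obtain ⟨A, hA, hform⟩ := exists_firstMoment_smoothedDomain_zero m
  let u : ℕ → ℝ := fun j => 1 / ((j : ℝ) + 1) / 3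
  have hpos : ∀ j, 0 < u j := fun j => by positivity
  have hanti : Antitone u := fun i j hij => by
    simp only [u]
    gcongr
  have hlim : Tendsto u atTop (𝓝 0) := by
    simpa [u] using (tendsto_one_div_add_atTop_nhds_zero_nat (𝕜 := ℝ)).div_const 3
  have hlt : ∀ j, u j < 1 / 2 := fun j =>
    (hanti (Nat.zero_le j)).trans_lt (by norm_num [u])
  have hc : Continuous fun ε : ℝ =>
      smoothedDefiningFunction m ε (Pi.single 0 (σ : ℂ) : Fin (m + 1) → ℂ) := by
    unfold smoothedDefiningFunction smoothedNorm
    fun_prop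
  have hev : ∀ᶠ j in atTop, (σ : ℂ) ∈ firstAxisSlice (smoothedDomain m (u j)) :=
    ((hc.tendsto 0).comp hlim).eventually_lt_const
      (ofReal_mem_firstAxisSlice_smoothedDomain_zero hσ0 hσ1)
  obtain ⟨J, hJ⟩ := hev.exists
  have hR : ∀ j, IsCompleteReinhardtInCylinder (smoothedDomain m (u j)) := fun j =>
    smoothedDomain_isCompleteReinhardt (hpos j).le
  -- Moments grow with the domain, so the majorant for index `J` dominates the series for every
  -- later index.
  obtain ⟨B, hB0, hB, hsum⟩ := (hR J).exists_summable_pow_div_firstMoment hJ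
  have hσB : σ ^ 2 ≤ B := by
    have := hB _ hJ
    rw [Pi.single_eq_same, Complex.norm_real, Real.norm_of_nonneg hσ0.le] at this
    rwa [sq]
  have hJpos : ∀ k, 0 < firstMoment (smoothedDomain m (u J)) k :=
    (hR J).firstMoment_pos ((hR J).mem_slice_of_norm_le (by simp) hJ)
  have hmono : ∀ j, J ≤ j → ∀ k, firstMoment (smoothedDomain m (u J)) k ≤
      firstMoment (smoothedDomain m (u j)) k := fun j hj k =>
    setIntegral_mono_set ((hR j).integrableOn_norm_pow _) (ae_of_all _ fun w => by positivity)
      (smoothedDomain_anti (hpos j).le (hanti hj)).eventuallyLE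
  have hlimpos : ∀ k, 0 < firstMoment (smoothedDomain m 0) k := fun k => by
    rw [hform]
    have : 0 < (2 * k + 1 + (2 * m + 1)).choose (2 * m + 1) := Nat.choose_pos (by omega)
    positivity
  have ht := tendsto_tsum_of_dominated_convergence (𝓕 := atTop)
    (f := fun j k => (-σ ^ 2) ^ k / firstMoment (smoothedDomain m (u j)) k)
    (g := fun k => (-σ ^ 2) ^ k / firstMoment (smoothedDomain m 0) k) hsum
    (fun k => tendsto_const_nhds.div (tendsto_firstMoment_smoothedDomain m k hanti hpos hlim)
      (hlimpos k).ne')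
    (by
      filter_upwards [eventually_ge_atTop J] with j hj k
      have h1 := hJpos k
      have h2 := hmono j hj k
      rw [norm_div, norm_pow, norm_neg, norm_pow, Real.norm_of_nonneg hσ0.le,
        Real.norm_of_nonneg (h1.trans_le h2).le]
      gcongr)
  have hneg' : ∑' k, (-σ ^ 2) ^ k / firstMoment (smoothedDomain m 0) k < 0 := by
    have : ∀ k, (-σ ^ 2) ^ k / firstMoment (smoothedDomain m 0) k =
        A⁻¹ * (((2 * k + 1 + (2 * m + 1)).choose (2 * m + 1) : ℝ) * (-σ ^ 2) ^ k) := by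
      intro k
      rw [hform]
      field_simp
    simp only [this]
    rw [tsum_mul_left]
    exact mul_neg_of_pos_of_neg (by positivity) hneg
  obtain ⟨j, hj1, hj2⟩ := ((ht.eventually_lt_const hneg').and hev).exists
  exact ⟨u j, σ, hpos j, hlt j, hσ0, hj2, hj1⟩

/-! ### The zero of the kernel -/

/-- A kernel function that is negative at a pair of opposite points of the first axis has a
zero. -/
theorem IsCompleteReinhardtInCylinder.exists_tsum_eq_zero {m : ℕ} {Ω : Set (Fin (m + 1) → ℂ)}
    (h : IsCompleteReinhardtInCylinder Ω) {σ : ℝ} (hσ : 0 < σ) (hmem : (σ : ℂ) ∈ firstAxisSlice Ω)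
    (hneg : ∑' k, (-σ ^ 2) ^ k / firstMoment Ω k < 0) :
    ∃ s : ℝ, (s : ℂ) ∈ firstAxisSlice Ω ∧ (-s : ℂ) ∈ firstAxisSlice Ω ∧
      ∑' k, (-s ^ 2) ^ k / firstMoment Ω k = 0 := by
  obtain ⟨B, hB0, hB, hsum⟩ := h.exists_summable_pow_div_firstMoment hmem
  have h0 := h.mem_slice_of_norm_le (ζ := 0) (by simp) hmem
  have hpos := h.firstMoment_pos h0
  have hσB : σ ^ 2 ≤ B := by
    have := hB _ hmem
    rw [Pi.single_eq_same, Complex.norm_real, Real.norm_of_nonneg hσ.le] at this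
    rwa [sq]
  have hcont : ContinuousOn (fun s : ℝ => ∑' k, (-s ^ 2) ^ k / firstMoment Ω k) (Icc 0 σ) := by
    refine continuousOn_tsum (fun k => by fun_prop) hsum fun k s hs => ?_
    rw [norm_div, norm_pow, norm_neg, norm_pow, Real.norm_of_nonneg hs.1,
      Real.norm_of_nonneg (hpos k).le]
    have : s ^ 2 ≤ B := (pow_le_pow_left₀ hs.1 hs.2 2).trans hσB
    have := hpos k
    gcongr
  -- At `s = 0` only the term `k = 0` remains; it is positive, which gives the sign change on `[0,
  -- σ]`.
  have hz : ∑' k, (-(0 : ℝ) ^ 2) ^ k / firstMoment Ω k = 1 / firstMoment Ω 0 := by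
    rw [tsum_eq_single 0 fun k hk => by simp [hk]]
    simp
  obtain ⟨s, hs, hs0⟩ := intermediate_value_Icc' hσ.le hcont
    (⟨hneg.le, by rw [hz]; have := hpos 0; positivity⟩ : (0 : ℝ) ∈ Icc _ _)
  have hle : ‖(s : ℂ)‖ ≤ ‖(σ : ℂ)‖ := by
    rw [Complex.norm_real, Complex.norm_real, Real.norm_of_nonneg hs.1, Real.norm_of_nonneg hσ.le]
    exact hs.2
  exact ⟨s, h.mem_slice_of_norm_le hle hmem, h.mem_slice_of_norm_le (by rwa [norm_neg]) hmem, hs0⟩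

theorem mainTheorem8 (n : ℕ) (hn : 3 ≤ n) :
    ∃ Ω : Set (Fin n → ℂ),
      IsDomainInCn Ω ∧ Bornology.IsBounded Ω ∧ IsReinhardt Ω ∧ IsStronglyConvexDomain Ω ∧
        HasBoundaryOfClass ∞ Ω ∧ HasBoundaryOfClass ω Ω ∧
        ∃ K : (Fin n → ℂ) → (Fin n → ℂ) → ℂ, IsBergmanKernel Ω K ∧
          ∃ z ∈ Ω, ∃ w ∈ Ω, K z w = 0 := by
  obtain ⟨m, rfl⟩ : ∃ m, n = m + 1 := ⟨n - 1, by omega⟩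
  obtain ⟨ε, σ, hε, hε2, hσ, hmem, hneg⟩ := exists_smoothedDomain_tsum_neg (m := m) (by omega)
  have h := smoothedDomain_isCompleteReinhardt (m := m) hε.le
  obtain ⟨K, hK, hKa⟩ := h.exists_isBergmanKernel
  obtain ⟨s, hs, hs', hs0⟩ := h.exists_tsum_eq_zero hσ hmem hneg
  refine ⟨smoothedDomain m ε, isDomainInCn_smoothedDomain hε.le hε2, h.isBounded,
    isReinhardt_smoothedDomain hε.le, isStronglyConvexDomain_smoothedDomain hε hε2,
    hasBoundaryOfClass_smoothedDomain hε hε2 _, hasBoundaryOfClass_smoothedDomain hε hε2 _,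
    K, hK, _, hs, _, hs', ?_⟩
  -- The zero is at `z = (s, 0)`, `w = (-s, 0)`, where `z₀ * conj w₀ = -s²`.
  rw [hKa, ← Complex.ofReal_zero, ← hs0, Complex.ofReal_tsum]
  refine tsum_congr fun k => ?_
  rw [Pi.single_eq_same, map_neg, Complex.conj_ofReal]
  push_cast
  ring
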